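/- Let $\mathfrak A=\overline{\bigotimes_{j\in\mathbb Z}M_2(\mathbb C)}^{\,C^*}$ be the UHF $C^*$-algebra of quasi-local observables of the spin-$\tfrac12$ chain on $\mathbb Z$, and for $Q\in M_2(\mathbb C)$ and $j\in\mathbb Z$ let $Q^{(j)}\in\mathfrak A$ be the element with $Q$ in the $j$-th tensor factor and $1$ in all the others. Let $\mathfrak A_R$ be the $C^*$-subalgebra of $\mathfrak A$ generated by all $Q^{(j)}$ with $j\ge 1$. Let $\tau_k$ ($k\in\mathbb Z$) be the automorphism of $\mathfrak A$ with $\tau_k(Q^{(j)})=Q^{(j+k)}$, and let $\gamma_\theta$ ($\theta\in\mathbb R$) be the automorphism of $\mathfrak A$ with $\gamma_\theta(Q^{(j)})=\bigl(e^{i\theta\sigma_z/2}\,Q\,e^{-i\theta\sigma_z/2}\bigr)^{(j)}$, where $\sigma_z=\mathrm{diag}(1,-1)$. Let $\varphi$ be a pure state of $\mathfrak A$ such that - $\varphi\circ\tau_k=\varphi$ for all $k\in\mathbb Z$ (translation invariance); - $\varphi\circ\gamma_\theta=\varphi$ for all $\theta\in\mathbb R$ ($U(1)$ gauge invariance); -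 the restriction $\varphi_R=\varphi|_{\mathfrak A_R}$ gives rise to a type I representation, i.e. the von Neumann algebra $\pi_{\varphi_R}(\mathfrak A_R)''$ generated by the GNS representation of $\varphi_R$ is of type I. Then $\varphi$ is a product state: for all $n\ge 0$, all pairwise distinct sites $j_1,\dots,j_n\in\mathbb Z$ and all $Q_1,\dots,Q_n\in M_2(\mathbb C)$, $$\varphi\bigl(Q_1^{(j_1)}\cdots Q_n^{(j_n)}\bigr)=\prod_{i=1}^n\varphi\bigl(Q_i^{(j_i)}\bigr).$$ -/

import Mathlib

open scoped ComplexOrder lp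

namespace SpinChain

/-! ### States, GNS representations and type I von Neumann algebras -/

section States

variable {A : Type*} [CStarAlgebra A]

/-- A state: a normalized positive linear functional on a unital C⋆-algebra. -/
structure State (A : Type*) [CStarAlgebra A] extends A →ₗ[ℂ] ℂ where
  nonneg : ∀ a : A, 0 ≤ toFun (star a * a)
  map_one : toFun 1 = 1

noncomputable instance : CoeFun (State A) (fun _ => A → ℂ) := ⟨fun φ => φ.toLinearMap⟩

/-- A pure state: an extreme point of the convex set of all states. -/
def State.IsPure (φ : State A) : Prop :=
  φ.toLinearMap ∈ Set.extremePoints ℝ (Set.range (State.toLinearMap (A := A)))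

/-- The restriction of a state to a C⋆-subalgebra. -/
noncomputable def State.restrict (φ : State A) (B : StarSubalgebra ℂ A) [IsClosed (B : Set A)] : State B where
  toLinearMap := φ.toLinearMap ∘ₗ B.subtype.toAlgHom.toLinearMap
  nonneg b := φ.nonneg (b : A)
  map_one := φ.map_one

section GNS

attribute [local instance] CStarAlgebra.spectralOrder CStarAlgebra.spectralOrderedRing

/-- A state as a positive linear map, where `A` carries its canonical order
(`a ≤ b` iff `b - a` is self-adjoint with nonnegative spectrum). -/
noncomputable def State.toPositiveLinearMap (φ : State A) : A →ₚ[ℂ] ℂ :=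
  PositiveLinearMap.mk₀ φ.toLinearMap (by
    intro a ha
    obtain ⟨b, rfl⟩ := CStarAlgebra.nonneg_iff_eq_star_mul_self.mp ha
    exact φ.nonneg b)

/-- The GNS Hilbert space of a state. -/
noncomputable abbrev State.GNSSpace (φ : State A) := φ.toPositiveLinearMap.GNS

/-- The GNS representation of a state. -/
noncomputable def State.gnsRep (φ : State A) :
    A →⋆ₐ[ℂ] (φ.GNSSpace →L[ℂ] φ.GNSSpace) :=
  φ.toPositiveLinearMap.gnsStarAlgHom

end GNS

section VonNeumann

variable {K : Type*} [NormedAddCommGroup K] [InnerProductSpace ℂ K] [CompleteSpace K]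

/-- The von Neumann algebra `S''` generated by a unital ⋆-algebra `S` of bounded operators. -/
noncomputable def bicommutant (S : StarSubalgebra ℂ (K →L[ℂ] K)) : VonNeumannAlgebra K where
  toStarSubalgebra :=
    StarSubalgebra.centralizer ℂ (StarSubalgebra.centralizer ℂ (S : Set (K →L[ℂ] K)))
  centralizer_centralizer' := by
    have h := StarSubalgebra.coe_centralizer_centralizer ℂ (S : Set (K →L[ℂ] K))
    change Set.centralizer (Set.centralizer (SetLike.coe (StarSubalgebra.centralizer ℂ
      (StarSubalgebra.centralizer ℂ (S : Set (K →L[ℂ] K)) : Set (K →L[ℂ] K))))) =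
      SetLike.coe (StarSubalgebra.centralizer ℂ
        (StarSubalgebra.centralizer ℂ (S : Set (K →L[ℂ] K)) : Set (K →L[ℂ] K)))
    rw [h, Set.centralizer_centralizer_centralizer]

/-- A von Neumann algebra `M` is of type I if every nonzero central projection `z` of `M`
dominates a nonzero abelian projection `e` of `M` (one for which `e M e` is commutative). -/
def IsTypeI (M : VonNeumannAlgebra K) : Prop :=
  ∀ z : K →L[ℂ] K, IsStarProjection z → z ∈ M → z ∈ M.commutant → z ≠ 0 →
    ∃ e : K →L[ℂ] K, IsStarProjection e ∧ e ∈ M ∧ e ≠ 0 ∧ z * e = e ∧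
      ∀ x ∈ M, ∀ y ∈ M, Commute (e * x * e) (e * y * e)

end VonNeumann

/-- The state gives rise to a type I representation: the von Neumann algebra `π_φ(A)''` generated
by its GNS representation is of type I. -/
def State.IsTypeIRep (φ : State A) : Prop :=
  IsTypeI (bicommutant φ.gnsRep.range)

end States

/-! ### The quasi-local algebra of the spin-1/2 chain

The C⋆-algebra `⨂_{ℤ} M₂(ℂ)` is realized on the incomplete infinite tensor product of copies of `ℂ²`
along the all-up vector, i.e. on `ℓ²` of the spin configurations with finitely many down spins.
The local matrix algebras act faithfully there, and the C⋆-norm of a full matrix algebra is unique,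
so the norm closure of the local algebra is the UHF algebra `2^∞`. -/

/-- Spin configurations on `ℤ` with finitely many down spins (`0` is up, `1` is down). -/
abbrev Config := ℤ →₀ Fin 2

/-- The Hilbert space with orthonormal basis the configurations. -/
noncomputable abbrev Space := ℓ²(Config, ℂ)

section Operators

theorem memlp_weighted (c : Config → ℂ) (hc : ∃ C : ℝ, ∀ s, ‖c s‖ ≤ C) (e : Equiv.Perm Config)
    (f : Space) : Memℓp (fun s => c s * f (e s)) 2 := by
  obtain ⟨C, hC⟩ := hc
  have hf : Summable fun s => ‖f s‖ ^ (2 : ENNReal).toReal := (lp.memℓp f).summable (by norm_num)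
  have hf' := ((e.summable_iff (f := fun s => ‖f s‖ ^ (2 : ENNReal).toReal)).mpr hf).mul_left (C ^ 2)
  refine memℓp_gen (Summable.of_nonneg_of_le (fun s => by positivity) (fun s => ?_) hf')
  simp only [ENNReal.toReal_ofNat, Real.rpow_ofNat, norm_mul, mul_pow, Function.comp_apply]
  gcongr
  exact hC s

/-- The bounded operator `f ↦ (s ↦ c s * f (e s))` for a bounded weight `c` and a permutation `e`
of the configurations. -/
noncomputable def weighted (c : Config → ℂ) (hc : ∃ C : ℝ, ∀ s, ‖c s‖ ≤ C)
    (e : Equiv.Perm Config) : Space →L[ℂ] Space :=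
  LinearMap.mkContinuousOfExistsBound
    { toFun := fun f => ⟨fun s => c s * f (e s), memlp_weighted c hc e f⟩
      map_add' := fun f g => by
        ext s
        exact mul_add _ _ _
      map_smul' := fun r f => by
        ext s
        simp [mul_left_comm] }
    (by
      obtain ⟨C, hC⟩ := hc
      refine ⟨C, fun f => ?_⟩
      have hC0 : 0 ≤ C := (norm_nonneg _).trans (hC 0)
      have h2 : 0 < (2 : ENNReal).toReal := by norm_num
      refine lp.norm_le_of_forall_sum_le h2 (by positivity) fun t => ?_
      have h := lp.sum_rpow_le_norm_rpow h2 f (t.map e.toEmbedding)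
      rw [Finset.sum_map] at h
      simp only [ENNReal.toReal_ofNat, Real.rpow_ofNat, mul_pow] at h ⊢
      calc _ ≤ ∑ s ∈ t, C ^ 2 * ‖f (e s)‖ ^ 2 := by
            refine Finset.sum_le_sum fun s _ => ?_
            simp only [LinearMap.coe_mk, AddHom.coe_mk, norm_mul, mul_pow]
            gcongr
            exact hC s
        _ ≤ _ := by
            rw [← Finset.mul_sum]
            gcongr
            exact h)

theorem weighted_apply (c : Config → ℂ) (hc : ∃ C : ℝ, ∀ s, ‖c s‖ ≤ C) (e : Equiv.Perm Config)
    (f : Space) (s : Config) : weighted c hc e f s = c s * f (e s) := rfl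

theorem star_weighted_apply (c : Config → ℂ) (hc : ∃ C : ℝ, ∀ s, ‖c s‖ ≤ C)
    (e : Equiv.Perm Config) (f : Space) (s : Config) :
    star (weighted c hc e) f s = star (c (e.symm s)) * f (e.symm s) := by
  have hc' : ∃ C : ℝ, ∀ s, ‖star (c (e.symm s))‖ ≤ C := by
    obtain ⟨C, hC⟩ := hc
    exact ⟨C, fun s => by simpa using hC (e.symm s)⟩
  have h : weighted (fun s => star (c (e.symm s))) hc' e.symm = star (weighted c hc e) := by
    rw [ContinuousLinearMap.star_eq_adjoint, ContinuousLinearMap.eq_adjoint_iff]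
    intro f g
    rw [lp.inner_eq_tsum, lp.inner_eq_tsum, ← e.tsum_eq]
    refine tsum_congr fun s => ?_
    simp [weighted_apply]
    ring
  rw [← h, weighted_apply]

/-- The operator `Q` acting on the spin at the site `j`, as an operator on `Space`. -/
noncomputable def siteOp (j : ℤ) (Q : Matrix (Fin 2) (Fin 2) ℂ) : Space →L[ℂ] Space :=
  ∑ b : Fin 2, weighted (fun s => Q (s j) (s j + b))
    ⟨∑ i, ∑ k, ‖Q i k‖, fun s =>
      (Finset.single_le_sum (f := fun k => ‖Q (s j) k‖) (fun _ _ => norm_nonneg _)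
        (Finset.mem_univ _)).trans
      (Finset.single_le_sum (f := fun i => ∑ k, ‖Q i k‖)
        (fun _ _ => Finset.sum_nonneg fun _ _ => norm_nonneg _) (Finset.mem_univ _))⟩
    (Equiv.addRight (Finsupp.single j b))

theorem add_single_eq_update (s : Config) (j : ℤ) (b : Fin 2) :
    s + Finsupp.single j b = s.update j (s j + b) := by
  ext i
  rcases eq_or_ne i j with rfl | h
  · simp
  · simp [h, Finsupp.update_apply]

/-- The matrix `Q` acts on the tensor factor at the site `j`. -/
theorem siteOp_apply (j : ℤ) (Q : Matrix (Fin 2) (Fin 2) ℂ) (f : Space) (s : Config) :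
    siteOp j Q f s = ∑ a : Fin 2, Q (s j) a * f (s.update j a) := by
  rw [siteOp, _root_.sum_apply, lp.coeFn_sum, Finset.sum_apply,
    ← Equiv.sum_comp (Equiv.addLeft (s j)) fun a => Q (s j) a * f (s.update j a)]
  refine Finset.sum_congr rfl fun b _ => ?_
  simp [weighted_apply, add_single_eq_update]

theorem siteOp_star (j : ℤ) (Q : Matrix (Fin 2) (Fin 2) ℂ) :
    siteOp j (star Q) = star (siteOp j Q) := by
  ext f s
  rw [siteOp_apply, siteOp, star_sum, _root_.sum_apply, lp.coeFn_sum,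
    Finset.sum_apply, ← (Equiv.subLeft (s j)).sum_comp]
  refine Finset.sum_congr rfl fun b _ => ?_
  have h : s - Finsupp.single j b = s.update j (s j - b) := by
    rw [sub_eq_add_neg, ← Finsupp.single_neg, add_single_eq_update, ← sub_eq_add_neg]
  rw [star_weighted_apply]
  simp [Matrix.star_apply, ← sub_eq_add_neg, h]

/-- The unital ⋆-homomorphism embedding `M₂(ℂ)` at the site `j`. -/
noncomputable def siteOpHom (j : ℤ) :
    Matrix (Fin 2) (Fin 2) ℂ →⋆ₐ[ℂ] (Space →L[ℂ] Space) :=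
  { AlgHom.ofLinearMap
      { toFun := siteOp j
        map_add' := fun Q R => by
          ext f s
          simp [siteOp_apply, add_mul]; ring
        map_smul' := fun r Q => by
          ext f s
          simp [siteOp_apply, mul_add, mul_assoc] }
      (by
        ext f s
        simp only [LinearMap.coe_mk, AddHom.coe_mk, siteOp_apply, Matrix.one_apply]
        simp)
      (fun Q R => by
        ext f s
        simp [siteOp_apply, Matrix.mul_apply]; ring) with
    map_star' := siteOp_star j }

/-- Observables at different sites commute. -/
theorem siteOp_commute {j k : ℤ} (h : j ≠ k) (Q R : Matrix (Fin 2) (Fin 2) ℂ) :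
    Commute (siteOp j Q) (siteOp k R) := by
  ext f s
  simp [siteOp_apply, Finsupp.update_apply, h, h.symm, Finsupp.update_comm s h]
  ring

/-- The quasi-local algebra of the spin-1/2 chain: the C⋆-algebra generated by all one-site
observables. -/
noncomputable def quasiLocal : StarSubalgebra ℂ (Space →L[ℂ] Space) :=
  (StarAlgebra.adjoin ℂ {T | ∃ j Q, T = siteOp j Q}).topologicalClosure

instance isClosed_quasiLocal : IsClosed (quasiLocal : Set (Space →L[ℂ] Space)) :=
  StarSubalgebra.isClosed_topologicalClosure _

theorem siteOp_mem (j : ℤ) (Q : Matrix (Fin 2) (Fin 2) ℂ) : siteOp j Q ∈ quasiLocal :=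
  StarSubalgebra.le_topologicalClosure _ (StarAlgebra.subset_adjoin ℂ _ ⟨j, Q, rfl⟩)

/-- The one-site observable `Q^{(j)}`, as a unital ⋆-homomorphism in `Q`. -/
noncomputable def site (j : ℤ) : Matrix (Fin 2) (Fin 2) ℂ →⋆ₐ[ℂ] quasiLocal :=
  (siteOpHom j).codRestrict quasiLocal (siteOp_mem j)

theorem coe_site (j : ℤ) (Q : Matrix (Fin 2) (Fin 2) ℂ) :
    (site j Q : Space →L[ℂ] Space) = siteOp j Q := rfl

/-- The C⋆-subalgebra of observables localized in `Λ`. -/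
noncomputable def localAlgebra (Λ : Set ℤ) : StarSubalgebra ℂ quasiLocal :=
  (StarAlgebra.adjoin ℂ {T | ∃ j ∈ Λ, ∃ Q, T = site j Q}).topologicalClosure

instance isClosed_localAlgebra (Λ : Set ℤ) : IsClosed (localAlgebra Λ : Set quasiLocal) :=
  StarSubalgebra.isClosed_topologicalClosure _

/-- The right half-chain algebra, localized in `[1, ∞)`. -/
noncomputable abbrev rightAlgebra : StarSubalgebra ℂ quasiLocal := localAlgebra (Set.Ici 1)

theorem conj_mem (U : unitary (Space →L[ℂ] Space))
    (hU : ∀ j Q, ∃ k R, (U : Space →L[ℂ] Space) * siteOp j Q = siteOp k R * U)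
    {T : Space →L[ℂ] Space} (hT : T ∈ quasiLocal) :
    Unitary.conjStarAlgAut ℂ (Space →L[ℂ] Space) U T ∈ quasiLocal := by
  let α := (Unitary.conjStarAlgAut ℂ (Space →L[ℂ] Space) U).toStarAlgHom
  have hα : Continuous α := by
    change Continuous fun T : Space →L[ℂ] Space =>
      (U : Space →L[ℂ] Space) * T * (star U : Space →L[ℂ] Space)
    fun_prop
  have hcl : IsClosed ((quasiLocal.comap α : StarSubalgebra ℂ (Space →L[ℂ] Space)) :
      Set (Space →L[ℂ] Space)) := isClosed_quasiLocal.preimage hα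
  have hle : quasiLocal ≤ quasiLocal.comap α := by
    refine StarSubalgebra.topologicalClosure_minimal (StarAlgebra.adjoin_le ?_) hcl
    rintro _ ⟨j, Q, rfl⟩
    obtain ⟨k, R, h⟩ := hU j Q
    change (U : Space →L[ℂ] Space) * siteOp j Q * (star U : Space →L[ℂ] Space) ∈ quasiLocal
    rw [h, mul_assoc, Unitary.mul_star_self_of_mem U.2, mul_one]
    exact siteOp_mem k R
  exact hle hT

/-- The automorphism of the quasi-local algebra implemented by a unitary that, together with its
inverse, maps one-site observables to one-site observables. -/
noncomputable def conjAut (U : unitary (Space →L[ℂ] Space))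
    (hU : ∀ j Q, ∃ k R, (U : Space →L[ℂ] Space) * siteOp j Q = siteOp k R * U)
    (hU' : ∀ j Q, ∃ k R, ((star U : unitary (Space →L[ℂ] Space)) : Space →L[ℂ] Space) * siteOp j Q
      = siteOp k R * (star U : unitary (Space →L[ℂ] Space))) :
    quasiLocal ≃⋆ₐ[ℂ] quasiLocal :=
  StarAlgEquiv.ofStarAlgHom
    ((((Unitary.conjStarAlgAut ℂ (Space →L[ℂ] Space) U).toStarAlgHom).comp
      quasiLocal.subtype).codRestrict quasiLocal fun T => conj_mem U hU T.2)
    ((((Unitary.conjStarAlgAut ℂ (Space →L[ℂ] Space) (star U)).toStarAlgHom).comp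
      quasiLocal.subtype).codRestrict quasiLocal fun T => conj_mem (star U) hU' T.2)
    (by
      ext1 T
      apply Subtype.ext
      change Unitary.conjStarAlgAut ℂ (Space →L[ℂ] Space) (star U)
        (Unitary.conjStarAlgAut ℂ (Space →L[ℂ] Space) U T) = T
      rw [← Unitary.conjStarAlgAut_symm, StarAlgEquiv.symm_apply_apply])
    (by
      ext1 T
      apply Subtype.ext
      change Unitary.conjStarAlgAut ℂ (Space →L[ℂ] Space) U
        (Unitary.conjStarAlgAut ℂ (Space →L[ℂ] Space) (star U) T) = T
      rw [← Unitary.conjStarAlgAut_symm, StarAlgEquiv.apply_symm_apply])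

theorem conjAut_site (U : unitary (Space →L[ℂ] Space)) (hU) (hU') {j k : ℤ}
    {Q R : Matrix (Fin 2) (Fin 2) ℂ}
    (h : (U : Space →L[ℂ] Space) * siteOp j Q = siteOp k R * U) :
    conjAut U hU hU' (site j Q) = site k R := by
  apply Subtype.ext
  change (U : Space →L[ℂ] Space) * siteOp j Q * (star U : Space →L[ℂ] Space) = siteOp k R
  rw [h, mul_assoc, Unitary.mul_star_self_of_mem U.2, mul_one]

/-- A weighted permutation operator with weights of modulus one is unitary. -/
noncomputable def weightedUnitary (c : Config → ℂ) (hc : ∀ s, ‖c s‖ = 1)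
    (e : Equiv.Perm Config) : unitary (Space →L[ℂ] Space) :=
  ⟨weighted c ⟨1, fun s => (hc s).le⟩ e, by
    rw [Unitary.mem_iff]
    constructor
    · ext f s
      have h := RCLike.conj_mul (c (e.symm s))
      rw [hc] at h
      simp [star_weighted_apply, weighted_apply, ← mul_assoc, h]
    · ext f s
      have h := RCLike.mul_conj (c s)
      rw [hc] at h
      simp [star_weighted_apply, weighted_apply, ← mul_assoc, h]⟩

/-- The configuration `s` shifted by `k`: the spin at `i` becomes `s (i + k)`. -/
def shiftConfig (k : ℤ) : Equiv.Perm Config :=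
  Finsupp.equivCongrLeft (Equiv.subRight k)

theorem shiftConfig_apply (k : ℤ) (s : Config) (i : ℤ) : shiftConfig k s i = s (i + k) := by
  simp [shiftConfig]

/-- The unitary shift on `Space`. -/
noncomputable def shiftUnitary (k : ℤ) : unitary (Space →L[ℂ] Space) :=
  weightedUnitary (fun _ => 1) (fun _ => by simp) (shiftConfig k)

theorem shiftUnitary_mul_siteOp (k j : ℤ) (Q : Matrix (Fin 2) (Fin 2) ℂ) :
    (shiftUnitary k : Space →L[ℂ] Space) * siteOp j Q
      = siteOp (k + j) Q * shiftUnitary k := by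
  ext f s
  have h (a : Fin 2) : (shiftConfig k s).update j a = shiftConfig k (s.update (k + j) a) := by
    ext i
    simp only [Finsupp.update_apply, shiftConfig_apply]
    grind
  simp [shiftUnitary, weightedUnitary, siteOp_apply, weighted_apply,
    h, shiftConfig_apply, add_comm j k]

theorem star_shiftUnitary (k : ℤ) : star (shiftUnitary k) = shiftUnitary (-k) := by
  apply Subtype.ext
  ext f s
  have h : (shiftConfig k).symm s = shiftConfig (-k) s := by
    rw [Equiv.symm_apply_eq]
    ext i
    simp [shiftConfig_apply]
  simp [shiftUnitary, weightedUnitary, star_weighted_apply, weighted_apply, h]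

/-- The lattice translation `τ_k`. -/
noncomputable def translation (k : ℤ) : quasiLocal ≃⋆ₐ[ℂ] quasiLocal :=
  conjAut (shiftUnitary k) (fun j Q => ⟨_, _, shiftUnitary_mul_siteOp k j Q⟩)
    (fun j Q => ⟨_, _, by rw [star_shiftUnitary]; exact shiftUnitary_mul_siteOp (-k) j Q⟩)

theorem translation_site (k j : ℤ) (Q : Matrix (Fin 2) (Fin 2) ℂ) :
    translation k (site j Q) = site (k + j) Q :=
  conjAut_site _ _ _ (shiftUnitary_mul_siteOp k j Q)

/-- The one-site rotation `exp (i θ σ_z / 2)`, with `σ_z = diag (1, -1)`. -/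
noncomputable def rotZ (θ : ℝ) : Matrix (Fin 2) (Fin 2) ℂ :=
  Matrix.diagonal ![Complex.exp (Complex.I * θ / 2), Complex.exp (-(Complex.I * θ / 2))]

/-- The unitary `exp (i θ ∑_j (σ_z^{(j)} - 1) / 2)` on `Space`: each down spin contributes the
phase `exp (-i θ)`. Subtracting the constant does not change the adjoint action. -/
noncomputable def gaugeUnitary (θ : ℝ) : unitary (Space →L[ℂ] Space) :=
  weightedUnitary
    (fun s => Complex.exp (((-θ * (s.sum fun _ a => (a : ℕ)) : ℝ) : ℂ) * Complex.I))
    (fun _ => Complex.norm_exp_ofReal_mul_I _) (Equiv.refl _)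

theorem gaugeUnitary_mul_siteOp (θ : ℝ) (j : ℤ) (Q : Matrix (Fin 2) (Fin 2) ℂ) :
    (gaugeUnitary θ : Space →L[ℂ] Space) * siteOp j Q
      = siteOp j (rotZ θ * Q * rotZ (-θ)) * gaugeUnitary θ := by
  ext f s
  have hN (t : Config) : (t.sum fun _ a => (a : ℕ)) =
      (t j : ℕ) + (t.erase j).sum fun _ a => (a : ℕ) :=
    (Finsupp.add_sum_erase' t j (fun _ a => (a : ℕ)) (fun _ => rfl)).symm
  have hupd (a : Fin 2) : ((s.update j a).sum fun _ a => (a : ℕ)) =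
      (a : ℕ) + (s.erase j).sum fun _ a => (a : ℕ) := by
    rw [hN (s.update j a), Finsupp.erase_update_eq_erase]
    simp
  simp only [gaugeUnitary, weightedUnitary, mul_apply_eq_comp, siteOp_apply, weighted_apply,
    Equiv.refl_apply, hupd, hN s, Finset.mul_sum]
  generalize ((s.erase j).sum fun _ a => (a : ℕ)) = N
  refine Finset.sum_congr rfl fun a _ => ?_
  simp only [← mul_assoc]
  congr 1
  generalize s j = b
  simp only [rotZ, Matrix.mul_diagonal, Matrix.diagonal_mul]
  rw [mul_comm, mul_right_comm _ (Q b a), mul_right_comm _ (Q b a), mul_comm _ (Q b a)]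
  congr 1
  fin_cases a <;> fin_cases b <;>
    · simp [← Complex.exp_add]
      try ring_nf

theorem star_gaugeUnitary (θ : ℝ) : star (gaugeUnitary θ) = gaugeUnitary (-θ) := by
  apply Subtype.ext
  ext f s
  simp [gaugeUnitary, weightedUnitary, star_weighted_apply, weighted_apply, ← Complex.exp_conj]

/-- The gauge action `γ_θ = Ad (exp (i θ S_z))`, `S_z = ½ ∑_j σ_z^{(j)}`. -/
noncomputable def gauge (θ : ℝ) : quasiLocal ≃⋆ₐ[ℂ] quasiLocal :=
  conjAut (gaugeUnitary θ) (fun j Q => ⟨_, _, gaugeUnitary_mul_siteOp θ j Q⟩)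
    (fun j Q => ⟨_, _, by rw [star_gaugeUnitary]; exact gaugeUnitary_mul_siteOp (-θ) j Q⟩)

theorem gauge_site (θ : ℝ) (j : ℤ) (Q : Matrix (Fin 2) (Fin 2) ℂ) :
    gauge θ (site j Q) = site j (rotZ θ * Q * rotZ (-θ)) :=
  conjAut_site _ _ _ (gaugeUnitary_mul_siteOp θ j Q)

end Operators

/-- A product state: `φ (Q₁^{(j₁)} ⋯ Qₙ^{(jₙ)}) = φ (Q₁^{(j₁)}) ⋯ φ (Qₙ^{(jₙ)})` for distinct sites
`j₁, …, jₙ`. -/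
def IsProductState (φ : State quasiLocal) : Prop :=
  ∀ (l : List ℤ) (Q : ℤ → Matrix (Fin 2) (Fin 2) ℂ), l.Nodup →
    φ (l.map fun j => site j (Q j)).prod = (l.map fun j => φ (site j (Q j))).prod

end SpinChain

/-! Let `Ω` be the cyclic vector of the GNS representation of `φ` and `T` the unitary on its space
that implements the shift by one site and fixes `Ω`. The argument forces the density `p` of down
spins to be an integer. Then `p` is `0` or `1`, every spin points in the same direction, and such a
state factorizes.

Type I supplies an abelian projection `e` in the von Neumann algebra of the right half-chain. Since
`φ` is pure, its GNS representation is irreducible, and this makes `e` minimal: `e y e` is a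
multiple of `e` for every `y` in that algebra (`exists_smul_of_inBicommutant`). The gauge rotation
by a small `θ` carries `e` to another minimal projection, close to `e` on a fixed vector in the
range of `e`. Comparing the two gives a unitary `U θ` on the full GNS space which rotates only the
right half-chain, leaves the left one alone, and tends strongly to `1` as `θ → 0`
(`exists_implements_tendsto`). Powers of these give implementers for every angle.

Write `Z` for the rotation `diag (1, exp (-iθ))` of the spin at site `1`. Then `Z T U T*` implements
the same half-chain rotation as `U`, so by irreducibility `U = χ(θ) Z T U T*` with a phase `χ(θ)`.
This phase is a character with `χ(2π) = 1`, continuous at `0`, hence `χ(θ) = exp (imθ)` with `m` an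
integer (`IsIrreducibleRep.exists_character`, `exists_int_of_character`).

Iterating the relation on `Ω` gives `|φ(exp (-iθ(N_n - mn))) - 1| ≤ 2 ‖U Ω - Ω‖`, where `N_n` counts
the down spins on the sites `1, …, n`. The bound does not depend on `n` (`norm_pow_mul_sub_one_le`).
The characteristic functions of `N_n - mn` are thus near `1` uniformly in `n` for small `θ`, which
is incompatible with a mean `n(p - m)` growing linearly (`abs_sum_le_of_sum_cos_le`). Therefore `p =
m`. -/

open scoped ComplexStarModule CStarAlgebra

namespace SpinChain

/-! ### Gram matrices, total families and strong limits -/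

section Hilbert

variable {H K : Type*} [NormedAddCommGroup H] [InnerProductSpace ℂ H]
  [NormedAddCommGroup K] [InnerProductSpace ℂ K]

/-- A family with the same Gram matrix as a total family is its image under a linear isometry. -/
theorem exists_linearIsometry_of_inner_eq [CompleteSpace K] {ι : Type*} (f : ι → H) (g : ι → K)
    (hf : Dense (Submodule.span ℂ (Set.range f) : Set H))
    (h : ∀ i j, inner ℂ (g i) (g j) = inner ℂ (f i) (f j)) :
    ∃ L : H →ₗᵢ[ℂ] K, ∀ i, L (f i) = g i := by
  let F := Finsupp.linearCombination ℂ f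
  let G := Finsupp.linearCombination ℂ g
  have hd : DenseRange F := by
    rw [← Finsupp.range_linearCombination] at hf
    exact hf
  have hin : ∀ x y, inner ℂ (G x) (G y) = inner ℂ (F x) (F y) := by
    intro x y
    simp only [F, G, Finsupp.linearCombination_apply, Finsupp.sum, sum_inner, inner_sum, inner_smul_left, inner_smul_right, h]
  have hn : ∀ x, ‖G x‖ = ‖F x‖ := fun x => by
    rw [@norm_eq_sqrt_re_inner ℂ, @norm_eq_sqrt_re_inner ℂ, hin]
  have hle : ∃ C, ∀ x, ‖G x‖ ≤ C * ‖F x‖ := ⟨1, fun x => by rw [one_mul, hn]⟩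
  refine ⟨⟨(G.extendOfNorm F : H →L[ℂ] K).toLinearMap, fun x => ?_⟩, fun i => ?_⟩
  · refine hd.induction_on (p := fun x => ‖G.extendOfNorm F x‖ = ‖x‖) x
      (isClosed_eq (by fun_prop) (by fun_prop)) fun a => ?_
    rw [LinearMap.extendOfNorm_eq hd hle, hn]
  · have := LinearMap.extendOfNorm_eq hd hle (Finsupp.single i 1)
    simpa [F, G] using this

/-- Two total families with the same Gram matrix are related by a unitary. -/
theorem exists_unitary_of_inner_eq [CompleteSpace H] {ι : Type*} (f g : ι → H)
    (hf : Dense (Submodule.span ℂ (Set.range f) : Set H))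
    (hg : Dense (Submodule.span ℂ (Set.range g) : Set H))
    (h : ∀ i j, inner ℂ (g i) (g j) = inner ℂ (f i) (f j)) :
    ∃ U : unitary (H →L[ℂ] H), ∀ i, (U : H →L[ℂ] H) (f i) = g i := by
  obtain ⟨L, hL⟩ := exists_linearIsometry_of_inner_eq f g hf h
  have hs : Function.Surjective L := by
    rw [← Set.range_eq_univ]
    refine (L.isometry.isClosedEmbedding.isClosed_range.closure_eq).symm.trans ?_
    refine (hg.mono ?_).closure_eq
    have : Submodule.span ℂ (Set.range g) ≤ LinearMap.range L.toLinearMap := by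
      rw [Submodule.span_le]
      rintro _ ⟨i, rfl⟩
      exact ⟨f i, hL i⟩
    exact this
  refine ⟨Unitary.linearIsometryEquiv.symm (LinearIsometryEquiv.ofSurjective L hs), fun i => ?_⟩
  exact hL i

/-- Two continuous linear maps that agree on a total family are equal. -/
theorem eq_of_eqOn_total {ι : Type*} {f : ι → H}
    (hf : Dense (Submodule.span ℂ (Set.range f) : Set H)) {S T : H →L[ℂ] K}
    (h : ∀ i, S (f i) = T (f i)) : S = T :=
  ContinuousLinearMap.ext_on hf (by rintro _ ⟨i, rfl⟩; exact h i)

/-- Vectors with the same inner products against a total family are equal. -/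
theorem eq_of_inner_total {ι : Type*} {f : ι → H}
    (hf : Dense (Submodule.span ℂ (Set.range f) : Set H)) {x y : H}
    (h : ∀ i, inner ℂ (f i) x = inner ℂ (f i) y) : x = y := by
  have : innerSL ℂ x = innerSL ℂ y := eq_of_eqOn_total hf fun i => by
    rw [innerSL_apply_apply, innerSL_apply_apply, ← inner_conj_symm, h, inner_conj_symm]
  exact ext_inner_right ℂ fun v => DFunLike.congr_fun this v

/-- The vectors fixed in the limit by a family of contractions form a closed subspace. -/
theorem tendsto_of_total {ι α : Type*} {l : Filter α} (U : α → H →L[ℂ] H)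
    (hU : ∀ a x, ‖U a x‖ ≤ ‖x‖) {f : ι → H}
    (hf : Dense (Submodule.span ℂ (Set.range f) : Set H))
    (h : ∀ i, Filter.Tendsto (fun a => U a (f i)) l (nhds (f i))) (x : H) :
    Filter.Tendsto (fun a => U a x) l (nhds x) := by
  have hspan : ∀ y ∈ Submodule.span ℂ (Set.range f),
      Filter.Tendsto (fun a => U a y) l (nhds y) := by
    intro y hy
    induction hy using Submodule.span_induction with
    | mem y hy => obtain ⟨i, rfl⟩ := hy; exact h i
    | zero => simpa using tendsto_const_nhds
    | add y z _ _ hy hz => simpa using hy.add hz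
    | smul c y _ hy => simpa using hy.const_smul c
  rw [Metric.tendsto_nhds]
  intro ε hε
  obtain ⟨y, hy, hxy⟩ := Metric.mem_closure_iff.mp (hf x) (ε / 3) (by positivity)
  filter_upwards [Metric.tendsto_nhds.mp (hspan y hy) (ε / 3) (by positivity)] with a ha
  rw [dist_eq_norm] at *
  have h1 : ‖U a (x - y)‖ ≤ ‖x - y‖ := hU a _
  have h2 : U a x - x = U a (x - y) + (U a y - y) + (y - x) := by rw [map_sub]; abel
  rw [h2]
  have h3 := norm_add₃_le (a := U a (x - y)) (b := U a y - y) (c := y - x)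
  rw [norm_sub_rev y x] at h3
  linarith

end Hilbert

/-! ### GNS representation and irreducibility for pure states -/

section GNS

variable {A : Type*} [CStarAlgebra A]

attribute [local instance] CStarAlgebra.spectralOrder CStarAlgebra.spectralOrderedRing

/-- The cyclic vector of the GNS representation. -/
noncomputable def State.cyclicVector (φ : State A) : φ.GNSSpace :=
  ((φ.toPositiveLinearMap.toPreGNS 1 : φ.toPositiveLinearMap.PreGNS) : φ.GNSSpace)

theorem State.gnsRep_cyclicVector (φ : State A) (a : A) :
    φ.gnsRep a φ.cyclicVector =
      ((φ.toPositiveLinearMap.toPreGNS a : φ.toPositiveLinearMap.PreGNS) : φ.GNSSpace) := by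
  unfold State.gnsRep State.cyclicVector
  erw [PositiveLinearMap.gnsNonUnitalStarAlgHom_apply_coe]
  simp

theorem State.inner_gnsRep (φ : State A) (a b : A) :
    inner ℂ (φ.gnsRep a φ.cyclicVector) (φ.gnsRep b φ.cyclicVector) = φ (star a * b) := by
  rw [State.gnsRep_cyclicVector, State.gnsRep_cyclicVector, UniformSpace.Completion.inner_coe]
  rfl

theorem State.inner_cyclicVector_gnsRep (φ : State A) (a : A) :
    inner ℂ φ.cyclicVector (φ.gnsRep a φ.cyclicVector) = φ a := by
  simpa using φ.inner_gnsRep 1 a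

theorem State.norm_cyclicVector (φ : State A) : ‖φ.cyclicVector‖ = 1 := by
  rw [@norm_eq_sqrt_re_inner ℂ]
  have := φ.inner_cyclicVector_gnsRep 1
  simp only [_root_.map_one, one_apply_eq_self] at this
  rw [this, show φ.toLinearMap 1 = 1 from φ.map_one]
  simp

theorem State.dense_gnsRep (φ : State A) :
    Dense (Submodule.span ℂ (Set.range fun a => φ.gnsRep a φ.cyclicVector) : Set φ.GNSSpace) := by
  refine Dense.mono Submodule.subset_span ?_
  have : (fun a => φ.gnsRep a φ.cyclicVector) =
      fun a : A => ((φ.toPositiveLinearMap.toPreGNS a : φ.toPositiveLinearMap.PreGNS) :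
        φ.GNSSpace) := funext φ.gnsRep_cyclicVector
  rw [this]
  exact (UniformSpace.Completion.denseRange_coe (α := φ.toPositiveLinearMap.PreGNS)).comp
    φ.toPositiveLinearMap.toPreGNS.surjective.denseRange
      (UniformSpace.Completion.continuous_coe _)

/-- A positive operator in the commutant of the GNS representation defines a state. -/
theorem State.exists_state_of_commute (φ : State A) {T : φ.GNSSpace →L[ℂ] φ.GNSSpace}
    (hT : ∀ a, Commute T (φ.gnsRep a)) (hpos : ∀ x, 0 ≤ inner ℂ x (T x))
    (h0 : inner ℂ φ.cyclicVector (T φ.cyclicVector) ≠ 0) :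
    ∃ ψ : State A, ∀ a, ψ a = (inner ℂ φ.cyclicVector (T φ.cyclicVector))⁻¹ *
      inner ℂ φ.cyclicVector (T (φ.gnsRep a φ.cyclicVector)) := by
  refine ⟨⟨
    { toFun := fun a => (inner ℂ φ.cyclicVector (T φ.cyclicVector))⁻¹ *
        inner ℂ φ.cyclicVector (T (φ.gnsRep a φ.cyclicVector))
      map_add' := fun a b => by simp [inner_add_right, mul_add]
      map_smul' := fun c a => by simp [inner_smul_right]; ring }, fun a => ?_, ?_⟩,
    fun a => rfl⟩
  · have h : T (φ.gnsRep (star a * a) φ.cyclicVector) =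
        star (φ.gnsRep a) (T (φ.gnsRep a φ.cyclicVector)) := by
      rw [← map_star]
      have := DFunLike.congr_fun (hT (star a)).eq (φ.gnsRep a φ.cyclicVector)
      rw [map_mul]
      exact this
    change 0 ≤ (inner ℂ φ.cyclicVector (T φ.cyclicVector))⁻¹ *
      inner ℂ φ.cyclicVector (T (φ.gnsRep (star a * a) φ.cyclicVector))
    rw [h, ContinuousLinearMap.star_eq_adjoint, ContinuousLinearMap.adjoint_inner_right]
    exact mul_nonneg (inv_nonneg.mpr (hpos _)) (hpos _)
  · change (inner ℂ φ.cyclicVector (T φ.cyclicVector))⁻¹ *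
      inner ℂ φ.cyclicVector (T (φ.gnsRep 1 φ.cyclicVector)) = 1
    rw [_root_.map_one, one_apply_eq_self, inv_mul_cancel₀ h0]

/-- The GNS representation of a pure state is irreducible: self-adjoint operators. -/
theorem State.IsPure.isSelfAdjoint_commutant {φ : State A} (hφ : φ.IsPure)
    {h : φ.GNSSpace →L[ℂ] φ.GNSSpace} (hsa : IsSelfAdjoint h)
    (hh : ∀ a, Commute h (φ.gnsRep a)) : ∃ c : ℂ, h = c • 1 := by
  set Ω := φ.cyclicVector with hΩ
  have hsym : ∀ x y, inner ℂ (h x) y = inner ℂ x (h y) :=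
    ContinuousLinearMap.isSelfAdjoint_iff_isSymmetric.mp hsa
  have hreal : ∀ x, inner ℂ x (h x) = ((inner ℂ x (h x)).re : ℂ) := fun x => by
    have := inner_conj_symm (𝕜 := ℂ) x (h x)
    rw [hsym] at this
    exact (Complex.conj_eq_iff_re.mp this).symm
  have hbd : ∀ x, |(inner ℂ x (h x)).re| ≤ ‖h‖ * ‖x‖ ^ 2 := fun x =>
    (Complex.abs_re_le_norm _).trans <| (norm_inner_le_norm _ _).trans <| by
      nlinarith [h.le_opNorm x, norm_nonneg x]
  -- The choice makes `t ‖h‖ < 1`, so `(1 + t h) / 2` and `(1 - t h) / 2` are positive operators in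
  -- the commutant with sum `1`. After normalization each gives a state.
  set t : ℝ := (‖h‖ + 1)⁻¹ with ht
  have ht0 : 0 < t := by positivity
  have hth : t * ‖h‖ < 1 := by
    rw [ht, inv_mul_lt_iff₀ (by positivity)]; linarith
  have hexp : ∀ s : ℝ, ∀ x, inner ℂ x (((2⁻¹ : ℂ) • (1 + (s : ℂ) • h)) x) =
      ((2⁻¹ * (‖x‖ ^ 2 + s * (inner ℂ x (h x)).re) : ℝ) : ℂ) := by
    intro s x
    simp only [smul_apply, add_apply, one_apply_eq_self,
      inner_smul_right, inner_add_right, inner_self_eq_norm_sq_to_K]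
    rw [hreal x]
    push_cast
    simp
  have hlow : ∀ s : ℝ, |s| = t → ∀ x, (1 - t * ‖h‖) * ‖x‖ ^ 2 ≤
      ‖x‖ ^ 2 + s * (inner ℂ x (h x)).re := by
    intro s hs x
    have h1 : |s * (inner ℂ x (h x)).re| ≤ t * (‖h‖ * ‖x‖ ^ 2) := by
      rw [abs_mul, hs]; gcongr; exact hbd x
    have h2 := (abs_le.mp h1).1
    linarith
  have key : ∀ s : ℝ, |s| = t → ∃ r : ℝ, 0 < r ∧ r = 2⁻¹ * (1 + s * (inner ℂ Ω (h Ω)).re) ∧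
      ∃ ψ : State A, ∀ a, (r : ℂ) * ψ a =
        inner ℂ Ω (((2⁻¹ : ℂ) • (1 + (s : ℂ) • h)) (φ.gnsRep a Ω)) := by
    intro s hs
    have hr := hexp s Ω
    rw [φ.norm_cyclicVector] at hr
    have hl := hlow s hs Ω
    rw [φ.norm_cyclicVector] at hl
    have hpos : 0 < 2⁻¹ * (1 ^ 2 + s * (inner ℂ Ω (h Ω)).re) := by nlinarith
    obtain ⟨ψ, hψ⟩ := φ.exists_state_of_commute (T := (2⁻¹ : ℂ) • (1 + (s : ℂ) • h))
      (fun a => ((Commute.one_left _).add_left ((hh a).smul_left _)).smul_left _)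
      (fun x => by
        rw [hexp]
        have := hlow s hs x
        have h3 : 0 ≤ (1 - t * ‖h‖) * ‖x‖ ^ 2 := mul_nonneg (by linarith) (by positivity)
        exact_mod_cast (by linarith : 0 ≤ 2⁻¹ * (‖x‖ ^ 2 + s * (inner ℂ x (h x)).re)))
      (by rw [hr]; exact_mod_cast hpos.ne')
    refine ⟨_, hpos, by simp, ψ, fun a => ?_⟩
    rw [hψ a, hr, mul_inv_cancel_left₀]
    exact_mod_cast hpos.ne'
  obtain ⟨r, hr, hre, ψ, hψ⟩ := key t (abs_of_pos ht0)
  obtain ⟨r', hr', hre', ψ', hψ'⟩ := key (-t) (by rw [abs_neg, abs_of_pos ht0])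
  -- The two states, weighted by `r` and `r'`, average to `φ`; extremality collapses the
  -- decomposition.
  have hφψ : ψ.toLinearMap = φ.toLinearMap := by
    refine (mem_extremePoints.mp hφ).2 ψ.toLinearMap ⟨ψ, rfl⟩ ψ'.toLinearMap ⟨ψ', rfl⟩
      ⟨r, r', hr, hr', by rw [hre, hre']; ring, ?_⟩ |>.1
    ext a
    have h1 := hψ a
    have h2 := hψ' a
    have h3 := φ.inner_cyclicVector_gnsRep a
    change (r : ℂ) * ψ a + (r' : ℂ) * ψ' a = φ a
    rw [h1, h2, ← h3, ← inner_add_right]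
    congr 1
    simp only [smul_apply, add_apply, one_apply_eq_self]
    push_cast
    module
  -- Equality of the states says that `h` has the matrix elements of a scalar against `Ω`; since `h`
  -- commutes with the representation, this spreads to all matrix elements on the cyclic orbit.
  have hfin : ∀ a, inner ℂ Ω (h (φ.gnsRep a Ω)) = inner ℂ Ω (h Ω) * φ a := by
    intro a
    have h1 := hψ a
    rw [show ψ.toLinearMap a = φ.toLinearMap a by rw [hφψ], hre] at h1
    simp only [smul_apply, add_apply, one_apply_eq_self,
      inner_smul_right, inner_add_right] at h1
    rw [φ.inner_cyclicVector_gnsRep a] at h1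
    rw [hreal Ω]
    push_cast at h1
    have ht0' : (t : ℂ) ≠ 0 := by exact_mod_cast ht0.ne'
    apply mul_left_cancel₀ ht0'
    linear_combination (-2) * h1
  refine ⟨inner ℂ Ω (h Ω), ?_⟩
  refine eq_of_eqOn_total φ.dense_gnsRep fun b => ?_
  refine eq_of_inner_total φ.dense_gnsRep fun a => ?_
  have h1 : φ.gnsRep (star a) (h (φ.gnsRep b Ω)) = h (φ.gnsRep (star a * b) Ω) := by
    rw [map_mul]
    exact (DFunLike.congr_fun (hh (star a)).eq (φ.gnsRep b Ω)).symm
  rw [← ContinuousLinearMap.adjoint_inner_right, ← ContinuousLinearMap.star_eq_adjoint, ← map_star,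
    h1, hfin, smul_apply, one_apply_eq_self, inner_smul_right, φ.inner_gnsRep]

/-- The GNS representation of a pure state is irreducible. -/
theorem State.IsPure.commutant_eq_scalars {φ : State A} (hφ : φ.IsPure)
    {S : φ.GNSSpace →L[ℂ] φ.GNSSpace} (hS : ∀ a, Commute S (φ.gnsRep a)) :
    ∃ c : ℂ, S = c • 1 := by
  have hS' : ∀ a, Commute (star S) (φ.gnsRep a) := fun a => by
    have := (hS (star a)).star_star
    rwa [map_star, star_star] at this
  obtain ⟨c, hc⟩ := hφ.isSelfAdjoint_commutant (ℜ S).2 fun a => by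
    rw [realPart_apply_coe]
    exact ((hS a).add_left (hS' a)).smul_left _
  obtain ⟨d, hd⟩ := hφ.isSelfAdjoint_commutant (ℑ S).2 fun a => by
    rw [imaginaryPart_apply_coe]
    exact (((hS a).sub_left (hS' a)).smul_left _).smul_left _
  refine ⟨c + Complex.I * d, ?_⟩
  rw [← realPart_add_I_smul_imaginaryPart S, hc, hd]
  module

end GNS

/-! ### Local algebras and the gauge action on them -/

section LocalAlgebras

theorem site_mem_localAlgebra {Λ : Set ℤ} {j : ℤ} (hj : j ∈ Λ) (Q : Matrix (Fin 2) (Fin 2) ℂ) :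
    site j Q ∈ localAlgebra Λ :=
  StarSubalgebra.le_topologicalClosure _ (StarAlgebra.subset_adjoin ℂ _ ⟨j, hj, Q, rfl⟩)

theorem localAlgebra_le {Λ : Set ℤ} {B : StarSubalgebra ℂ quasiLocal}
    (hB : IsClosed (B : Set quasiLocal)) (h : ∀ j ∈ Λ, ∀ Q, site j Q ∈ B) :
    localAlgebra Λ ≤ B := by
  refine StarSubalgebra.topologicalClosure_minimal (StarAlgebra.adjoin_le ?_) hB
  rintro _ ⟨j, hj, Q, rfl⟩
  exact h j hj Q

/-- The induction principle of the algebra: a closed condition stable under the ⋆-algebra operations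
need only be checked on one-site observables. The detour through the ambient operators is sound
because `quasiLocal` is closed there, so closed subsets of it stay closed. -/
theorem eq_top_of_site_mem {B : StarSubalgebra ℂ quasiLocal}
    (hB : IsClosed (B : Set quasiLocal)) (h : ∀ j Q, site j Q ∈ B) : B = ⊤ := by
  have hcl : IsClosed ((B.map quasiLocal.subtype : StarSubalgebra ℂ (Space →L[ℂ] Space)) :
      Set (Space →L[ℂ] Space)) :=
    isClosed_quasiLocal.isClosedEmbedding_subtypeVal.isClosedMap _ hB
  have hle : quasiLocal ≤ B.map quasiLocal.subtype := by
    refine StarSubalgebra.topologicalClosure_minimal (StarAlgebra.adjoin_le ?_) hcl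
    rintro _ ⟨j, Q, rfl⟩
    exact ⟨site j Q, h j Q, rfl⟩
  rw [eq_top_iff]
  rintro a -
  obtain ⟨b, hb, hab⟩ := hle a.2
  rwa [← Subtype.ext (a1 := b) (a2 := a) hab]

theorem localAlgebra_univ : localAlgebra Set.univ = ⊤ :=
  eq_top_of_site_mem (isClosed_localAlgebra _) fun _ Q => site_mem_localAlgebra (Set.mem_univ _) Q

variable {B : Type*} [CStarAlgebra B]

/-- What commutes with the one-site observables in `Λ` commutes with all observables in `Λ`. -/
theorem commute_of_site {Λ : Set ℤ} (π : quasiLocal →⋆ₐ[ℂ] B) {S : B}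
    (h : ∀ j ∈ Λ, ∀ Q, Commute S (π (site j Q))) {a : quasiLocal} (ha : a ∈ localAlgebra Λ) :
    Commute S (π a) := by
  have hcont : Continuous π := map_continuous π
  have hle : localAlgebra Λ ≤ (StarSubalgebra.centralizer ℂ {S}).comap π := by
    refine localAlgebra_le ?_ fun j hj Q => ?_
    · rw [StarSubalgebra.coe_comap, StarSubalgebra.coe_centralizer]
      refine IsClosed.preimage hcont ?_
      exact Set.isClosed_centralizer _
    · rw [StarSubalgebra.mem_comap, StarSubalgebra.mem_centralizer_iff]
      rintro _ rfl
      refine ⟨h j hj Q, ?_⟩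
      have := (h j hj (star Q)).star_star
      rwa [map_star, map_star, star_star] at this
  have := hle ha
  rw [StarSubalgebra.mem_comap, StarSubalgebra.mem_centralizer_iff] at this
  exact (this S rfl).1

theorem site_commute {j k : ℤ} (h : j ≠ k) (Q R : Matrix (Fin 2) (Fin 2) ℂ) :
    Commute (site j Q) (site k R) :=
  Subtype.ext (siteOp_commute h Q R).eq

theorem commute_site_of_mem {Λ : Set ℤ} {j : ℤ} (hj : j ∉ Λ) (Q : Matrix (Fin 2) (Fin 2) ℂ)
    {a : quasiLocal} (ha : a ∈ localAlgebra Λ) : Commute (site j Q) a :=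
  commute_of_site (StarAlgHom.id ℂ quasiLocal) (S := site j Q)
    (fun k hk R => site_commute (k := k) (by rintro rfl; exact hj hk) Q R) ha

theorem commute_of_mem_localAlgebra {Λ Λ' : Set ℤ} (h : Disjoint Λ Λ') {a b : quasiLocal}
    (ha : a ∈ localAlgebra Λ) (hb : b ∈ localAlgebra Λ') : Commute a b :=
  commute_of_site (StarAlgHom.id ℂ quasiLocal) (S := a)
    (fun _ hk R => (commute_site_of_mem (Set.disjoint_right.mp h hk) R ha).symm) hb

/-- A ⋆-homomorphism of the quasi-local algebra is determined by the one-site observables. -/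
theorem starAlgHom_ext_site {f g : quasiLocal →⋆ₐ[ℂ] B} (h : ∀ j Q, f (site j Q) = g (site j Q)) :
    f = g := by
  have : StarAlgHom.equalizer f g = ⊤ :=
    eq_top_of_site_mem (isClosed_eq (map_continuous f) (map_continuous g)) h
  ext a
  have ha : a ∈ StarAlgHom.equalizer f g := this ▸ StarSubalgebra.mem_top
  exact ha

theorem rotZ_mul (θ θ' : ℝ) : rotZ θ * rotZ θ' = rotZ (θ + θ') := by
  rw [rotZ, rotZ, rotZ, Matrix.diagonal_mul_diagonal]
  congr 1
  ext i
  fin_cases i <;> simp [← Complex.exp_add] <;> ring_nf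

theorem gauge_gauge (θ θ' : ℝ) (a : quasiLocal) : gauge θ (gauge θ' a) = gauge (θ + θ') a := by
  have : ((gauge θ).toStarAlgHom.comp (gauge θ').toStarAlgHom : quasiLocal →⋆ₐ[ℂ] quasiLocal) =
      (gauge (θ + θ')).toStarAlgHom := starAlgHom_ext_site fun j Q => by
    change gauge θ (gauge θ' (site j Q)) = gauge (θ + θ') (site j Q)
    simp only [gauge_site, ← rotZ_mul, neg_add, mul_assoc]
    rw [rotZ_mul (-θ'), add_comm (-θ'), ← rotZ_mul]
  exact DFunLike.congr_fun this a

theorem rotZ_zero : rotZ 0 = 1 := by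
  rw [rotZ, ← Matrix.diagonal_one]
  congr 1
  ext i
  fin_cases i <;> simp

theorem gauge_zero (a : quasiLocal) : gauge 0 a = a := by
  have : ((gauge 0).toStarAlgHom : quasiLocal →⋆ₐ[ℂ] quasiLocal) = StarAlgHom.id ℂ _ :=
    starAlgHom_ext_site fun j Q => by
      change gauge 0 (site j Q) = site j Q
      simp [gauge_site, rotZ_zero]
  exact DFunLike.congr_fun this a

theorem gauge_mem {Λ : Set ℤ} (θ : ℝ) {a : quasiLocal} (ha : a ∈ localAlgebra Λ) :
    gauge θ a ∈ localAlgebra Λ := by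
  have hle : localAlgebra Λ ≤ (localAlgebra Λ).comap (gauge θ).toStarAlgHom := by
    refine localAlgebra_le ((isClosed_localAlgebra Λ).preimage (map_continuous (gauge θ)))
      fun j hj Q => ?_
    change gauge θ (site j Q) ∈ localAlgebra Λ
    rw [gauge_site]
    exact site_mem_localAlgebra hj _
  exact hle ha

theorem continuous_site (j : ℤ) : Continuous (site j) :=
  LinearMap.continuous_of_finiteDimensional (site j).toAlgHom.toLinearMap

theorem continuous_rotZ : Continuous rotZ := by
  refine Continuous.matrix_diagonal (continuous_pi fun i => ?_)
  fin_cases i <;> simp <;> fun_prop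

/-- The gauge action is strongly continuous. -/
theorem tendsto_gauge (a : quasiLocal) :
    Filter.Tendsto (fun θ => gauge θ a) (nhds 0) (nhds a) := by
  let B : StarSubalgebra ℂ quasiLocal :=
    { carrier := {a | Filter.Tendsto (fun θ => gauge θ a) (nhds 0) (nhds a)}
      mul_mem' := fun {a b} ha hb => by
        simp only [Set.mem_ofPred_eq, map_mul] at *
        exact ha.mul hb
      add_mem' := fun {a b} ha hb => by
        simp only [Set.mem_ofPred_eq, map_add] at *
        exact ha.add hb
      algebraMap_mem' := fun r => by
        simp only [Set.mem_ofPred_eq]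
        have : ∀ θ, gauge θ (algebraMap ℂ quasiLocal r) = algebraMap ℂ quasiLocal r :=
          fun θ => AlgHomClass.commutes (gauge θ) r
        simp only [this]
        exact tendsto_const_nhds
      star_mem' := fun {a} ha => by
        simp only [Set.mem_ofPred_eq, map_star] at *
        exact ha.star }
  -- Automorphisms are contractive, so an `ε / 3` approximation by an element of `B` is uniform in
  -- `θ`.
  have hB : IsClosed (B : Set quasiLocal) := by
    refine isClosed_of_closure_subset fun x hx => ?_
    change Filter.Tendsto (fun θ => gauge θ x) (nhds 0) (nhds x)
    rw [Metric.tendsto_nhds]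
    intro ε hε
    obtain ⟨y, hy, hxy⟩ := Metric.mem_closure_iff.mp hx (ε / 3) (by positivity)
    filter_upwards [Metric.tendsto_nhds.mp hy (ε / 3) (by positivity)] with θ hθ
    have h1 : dist (gauge θ x) (gauge θ y) ≤ dist x y := by
      rw [dist_eq_norm, dist_eq_norm, ← map_sub]
      exact NonUnitalStarAlgHom.norm_apply_le (gauge θ) (x - y)
    have h2 := dist_triangle4 (gauge θ x) (gauge θ y) y x
    rw [dist_comm y x] at h2
    linarith
  have : B = ⊤ := eq_top_of_site_mem hB fun j Q => by
    change Filter.Tendsto (fun θ => gauge θ (site j Q)) (nhds 0) (nhds (site j Q))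
    simp only [gauge_site]
    have hc : Continuous fun θ => site j (rotZ θ * Q * rotZ (-θ)) :=
      (continuous_site j).comp ((continuous_rotZ.mul continuous_const).mul
        (continuous_rotZ.comp continuous_neg))
    have := hc.tendsto 0
    simpa [rotZ_zero] using this
  have ha : a ∈ B := this ▸ StarSubalgebra.mem_top
  exact ha

end LocalAlgebras

/-! ### Implementing half-chain rotations in an irreducible representation -/

section Implementers

variable {H : Type*} [NormedAddCommGroup H] [InnerProductSpace ℂ H] [CompleteSpace H]

/-- The left half-chain algebra, localized in `(-∞, 0]`. -/
noncomputable abbrev leftAlgebra : StarSubalgebra ℂ quasiLocal := localAlgebra (Set.Iic 0)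

theorem commute_left_right {a b : quasiLocal} (ha : a ∈ leftAlgebra) (hb : b ∈ rightAlgebra) :
    Commute a b := by
  have h : Disjoint (Set.Iic (0 : ℤ)) (Set.Ici 1) := by
    rw [Set.disjoint_left]
    intro j hj hj'
    rw [Set.mem_Iic] at hj
    rw [Set.mem_Ici] at hj'
    omega
  exact commute_of_mem_localAlgebra h ha hb

theorem site_mem_leftAlgebra {j : ℤ} (hj : j ≤ 0) (Q : Matrix (Fin 2) (Fin 2) ℂ) :
    site j Q ∈ leftAlgebra := site_mem_localAlgebra (Set.mem_Iic.mpr hj) Q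

theorem site_mem_rightAlgebra {j : ℤ} (hj : 1 ≤ j) (Q : Matrix (Fin 2) (Fin 2) ℂ) :
    site j Q ∈ rightAlgebra := site_mem_localAlgebra (Set.mem_Ici.mpr hj) Q

/-- A representation whose commutant consists of the scalars. -/
def IsIrreducibleRep (π : quasiLocal →⋆ₐ[ℂ] (H →L[ℂ] H)) : Prop :=
  ∀ S : H →L[ℂ] H, (∀ j Q, Commute S (π (site j Q))) → ∃ c : ℂ, S = c • 1

theorem State.IsPure.isIrreducibleRep {φ : State quasiLocal} (hφ : φ.IsPure) :
    IsIrreducibleRep φ.gnsRep := fun S hS =>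
  hφ.commutant_eq_scalars fun a => commute_of_site φ.gnsRep (Λ := Set.univ)
    (fun j _ Q => hS j Q) (by rw [localAlgebra_univ]; exact StarSubalgebra.mem_top)

theorem inner_map_left {A : Type*} [Semiring A] [Algebra ℂ A] [Star A] (π : A →⋆ₐ[ℂ] (H →L[ℂ] H)) (a : A) (x y : H) :
    inner ℂ (π a x) y = inner ℂ x (π (star a) y) := by
  rw [map_star, ContinuousLinearMap.star_eq_adjoint, ContinuousLinearMap.adjoint_inner_right]

/-- The projection onto a closed subspace invariant under an operator and its adjoint commutes with
the operator. -/
theorem commute_starProjection {E : Submodule ℂ H} [E.HasOrthogonalProjection] {T : H →L[ℂ] H}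
    (h : ∀ x ∈ E, T x ∈ E) (h' : ∀ x ∈ E, star T x ∈ E) : Commute E.starProjection T := by
  ext x
  change E.starProjection (T x) = T (E.starProjection x)
  refine (Submodule.eq_starProjection_of_mem_orthogonal (u := T x)
    (h _ (Submodule.starProjection_apply_mem E x)) ?_)
  rw [← map_sub, Submodule.mem_orthogonal]
  intro u hu
  rw [← ContinuousLinearMap.adjoint_inner_left, ← ContinuousLinearMap.star_eq_adjoint]
  exact E.sub_starProjection_mem_orthogonal x _ (h' u hu)

variable (π : quasiLocal →⋆ₐ[ℂ] (H →L[ℂ] H))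

/-- The vectors `π(l) π(r) vᵢ` with `l` in the left and `r` in the right half-chain algebra. -/
noncomputable def orbit {ι : Type*} (v : ι → H) (p : leftAlgebra × rightAlgebra × ι) : H :=
  π p.1 (π p.2.1 (v p.2.2))

variable {π} {ι : Type*}

theorem map_site_orbit_left (v : ι → H) {j : ℤ} (hj : j ≤ 0) (Q : Matrix (Fin 2) (Fin 2) ℂ)
    (p : leftAlgebra × rightAlgebra × ι) :
    π (site j Q) (orbit π v p) =
      orbit π v (⟨site j Q, site_mem_leftAlgebra hj Q⟩ * p.1, p.2) := by
  simp [orbit]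

theorem map_right_map_left {l r : quasiLocal} (hl : l ∈ leftAlgebra) (hr : r ∈ rightAlgebra)
    (x : H) : π r (π l x) = π l (π r x) := by
  have := congrArg π (commute_left_right hl hr).eq
  rw [map_mul, map_mul] at this
  exact (DFunLike.congr_fun this x).symm

theorem map_site_orbit_right (v : ι → H) {j : ℤ} (hj : 1 ≤ j) (Q : Matrix (Fin 2) (Fin 2) ℂ)
    (p : leftAlgebra × rightAlgebra × ι) :
    π (site j Q) (orbit π v p) =
      orbit π v (p.1, ⟨site j Q, site_mem_rightAlgebra hj Q⟩ * p.2.1, p.2.2) := by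
  simp [orbit, map_right_map_left p.1.2 (site_mem_rightAlgebra hj Q)]

/-- A nonzero family of vectors is cyclic for an irreducible representation. -/
theorem IsIrreducibleRep.dense_orbit (hπ : IsIrreducibleRep π) {v : ι → H} (hv : ∃ i, v i ≠ 0) :
    Dense (Submodule.span ℂ (Set.range (orbit π v)) : Set H) := by
  obtain ⟨i, hi⟩ := hv
  set E := (Submodule.span ℂ (Set.range (orbit π v))).topologicalClosure with hE
  have hinv : ∀ j Q, ∀ x ∈ E, π (site j Q) x ∈ E := by
    intro j Q
    have hle : Submodule.span ℂ (Set.range (orbit π v)) ≤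
        E.comap (π (site j Q)).toLinearMap := by
      rw [Submodule.span_le]
      rintro _ ⟨p, rfl⟩
      refine Submodule.le_topologicalClosure _ (Submodule.subset_span ?_)
      rcases le_or_gt j 0 with hj | hj
      · exact ⟨_, (map_site_orbit_left v hj Q p).symm⟩
      · exact ⟨_, (map_site_orbit_right v hj Q p).symm⟩
    exact Submodule.topologicalClosure_minimal _ hle
      ((Submodule.isClosed_topologicalClosure _).preimage (π (site j Q)).continuous)
  obtain ⟨c, hc⟩ := hπ E.starProjection fun j Q => commute_starProjection (hinv j Q) <| by
    rw [← map_star, ← map_star]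
    exact hinv j (star Q)
  have hvi : v i ∈ E := Submodule.le_topologicalClosure _
    (Submodule.subset_span ⟨(1, 1, i), by simp [orbit]⟩)
  have hc1 : c = 1 := by
    have h1 := Submodule.starProjection_eq_self_iff.mpr hvi
    rw [hc, smul_apply, one_apply_eq_self] at h1
    exact smul_left_injective ℂ hi (by simpa using h1)
  intro x
  have hx : x ∈ E := by
    rw [← Submodule.starProjection_eq_self_iff, hc, hc1]
    simp
  exact hx

/-- The two half-chains commute, so the Gram matrix of the orbit depends only on the correlations of
one left and one right observable. Matching those correlations is therefore enough to build a
unitary. -/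
theorem inner_orbit (u : ι → H) (p q : leftAlgebra × rightAlgebra × ι) :
    inner ℂ (orbit π u p) (orbit π u q) =
      inner ℂ (u p.2.2) (π (star (p.1 : quasiLocal) * (q.1 : quasiLocal))
        (π (star (p.2.1 : quasiLocal) * (q.2.1 : quasiLocal)) (u q.2.2))) := by
  obtain ⟨⟨l, hl⟩, ⟨r, hr⟩, i⟩ := p
  obtain ⟨⟨l', hl'⟩, ⟨r', hr'⟩, i'⟩ := q
  have hl₁ : star l ∈ leftAlgebra := star_mem hl
  have hr₁ : star r ∈ rightAlgebra := star_mem hr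
  change inner ℂ (π l (π r (u i))) (π l' (π r' (u i'))) =
    inner ℂ (u i) (π (star l * l') (π (star r * r') (u i')))
  rw [inner_map_left, inner_map_left, map_right_map_left hl₁ hr₁, map_right_map_left hl' hr₁,
    map_mul, map_mul]
  rfl

variable (π) in
/-- `U` acts trivially on the left half-chain and implements the gauge rotation on the right
half-chain. -/
def Implements (θ : ℝ) (U : H →L[ℂ] H) : Prop :=
  (∀ j ≤ 0, ∀ Q, Commute U (π (site j Q))) ∧
    ∀ j, 1 ≤ j → ∀ Q, U * π (site j Q) = π (gauge θ (site j Q)) * U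

-- By irreducibility both orbits are total, and `h` makes their Gram matrices equal, so sending one
-- orbit to the other is unitary. One-site observables act on the orbits by multiplying an index,
-- hence the intertwining relations. Whole families of vectors are allowed because the minimality
-- argument (with `θ = 0`) must control the entire range of a projection; the gauge argument uses a
-- single vector.
set_option maxHeartbeats 1000000 in
theorem IsIrreducibleRep.exists_implements (hπ : IsIrreducibleRep π) (θ : ℝ) {v w : ι → H}
    (hv : ∃ i, v i ≠ 0) (hw : ∃ i, w i ≠ 0)
    (h : ∀ i j, ∀ l ∈ leftAlgebra, ∀ r ∈ rightAlgebra,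
      inner ℂ (w i) (π l (π (gauge θ r) (w j))) = inner ℂ (v i) (π l (π r (v j)))) :
    ∃ U : unitary (H →L[ℂ] H), Implements π θ U ∧ ∀ l ∈ leftAlgebra, ∀ r ∈ rightAlgebra, ∀ i,
      (U : H →L[ℂ] H) (π l (π r (v i))) = π l (π (gauge θ r) (w i)) := by
  let g : leftAlgebra × rightAlgebra × ι → H := fun p =>
    orbit π w (p.1, ⟨gauge θ p.2.1, gauge_mem θ p.2.1.2⟩, p.2.2)
  have hg : Dense (Submodule.span ℂ (Set.range g) : Set H) := by
    refine (hπ.dense_orbit hw).mono (Submodule.span_mono ?_)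
    rintro _ ⟨p, rfl⟩
    refine ⟨(p.1, ⟨gauge (-θ) p.2.1, gauge_mem (-θ) p.2.1.2⟩, p.2.2), ?_⟩
    simp [g, gauge_gauge, gauge_zero]
  have hin : ∀ p q, inner ℂ (g p) (g q) = inner ℂ (orbit π v p) (orbit π v q) := by
    rintro ⟨⟨l, hl⟩, ⟨r, hr⟩, i⟩ ⟨⟨l', hl'⟩, ⟨r', hr'⟩, i'⟩
    have hl₁ : star l * l' ∈ leftAlgebra := mul_mem (star_mem hl) hl'
    have hr₁ : star r * r' ∈ rightAlgebra := mul_mem (star_mem hr) hr'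
    have key := h i i' _ hl₁ _ hr₁
    rw [map_mul (gauge θ), map_star (gauge θ)] at key
    exact (inner_orbit w (⟨l, hl⟩, ⟨gauge θ r, gauge_mem θ hr⟩, i)
      (⟨l', hl'⟩, ⟨gauge θ r', gauge_mem θ hr'⟩, i')).trans (key.trans
        (inner_orbit v (⟨l, hl⟩, ⟨r, hr⟩, i) (⟨l', hl'⟩, ⟨r', hr'⟩, i')).symm)
  obtain ⟨U, hU⟩ := exists_unitary_of_inner_eq _ g (hπ.dense_orbit hv) hg hin
  have hU' : ∀ l ∈ leftAlgebra, ∀ r ∈ rightAlgebra, ∀ i,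
      (U : H →L[ℂ] H) (π l (π r (v i))) = π l (π (gauge θ r) (w i)) :=
    fun l hl r hr i => hU (⟨l, hl⟩, ⟨r, hr⟩, i)
  have hmul : ∀ (a b : quasiLocal) (x : H), π a (π b x) = π (a * b) x := fun a b x => by
    rw [map_mul]; rfl
  refine ⟨U, ⟨fun j hj Q => ?_, fun j hj Q => ?_⟩, hU'⟩
  · refine eq_of_eqOn_total (hπ.dense_orbit hv) ?_
    rintro ⟨⟨l, hl⟩, ⟨r, hr⟩, i⟩
    change (U : H →L[ℂ] H) (π (site j Q) (π l (π r (v i)))) =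
      π (site j Q) ((U : H →L[ℂ] H) (π l (π r (v i))))
    have hs : site j Q * l ∈ leftAlgebra := mul_mem (site_mem_leftAlgebra hj Q) hl
    rw [hU' l hl r hr, hmul (site j Q) l, hU' _ hs r hr, hmul (site j Q) l]
  · refine eq_of_eqOn_total (hπ.dense_orbit hv) ?_
    rintro ⟨⟨l, hl⟩, ⟨r, hr⟩, i⟩
    change (U : H →L[ℂ] H) (π (site j Q) (π l (π r (v i)))) =
      π (gauge θ (site j Q)) ((U : H →L[ℂ] H) (π l (π r (v i))))
    have hs₁ : site j Q ∈ rightAlgebra := site_mem_rightAlgebra hj Q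
    have hs₂ : gauge θ (site j Q) ∈ rightAlgebra := gauge_mem θ hs₁
    have hs : site j Q * r ∈ rightAlgebra := mul_mem hs₁ hr
    have h₁ : ∀ x, π (site j Q) (π l x) = π l (π (site j Q) x) := map_right_map_left hl hs₁
    have h₂ : ∀ x, π (gauge θ (site j Q)) (π l x) = π l (π (gauge θ (site j Q)) x) :=
      map_right_map_left hl hs₂
    calc (U : H →L[ℂ] H) (π (site j Q) (π l (π r (v i))))
        = (U : H →L[ℂ] H) (π l (π (site j Q * r) (v i))) := by rw [h₁, hmul (site j Q) r]
      _ = π l (π (gauge θ (site j Q)) (π (gauge θ r) (w i))) := by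
        rw [hU' l hl _ hs, map_mul (gauge θ), hmul (gauge θ (site j Q)) (gauge θ r)]
      _ = π (gauge θ (site j Q)) ((U : H →L[ℂ] H) (π l (π r (v i)))) := by
        rw [hU' l hl r hr, h₂]

end Implementers

/-! ### Self-adjoint contractions as real parts of unitaries -/

section UnitaryOfSelfAdjoint

attribute [local instance] CStarAlgebra.spectralOrder CStarAlgebra.spectralOrderedRing

/-- A self-adjoint contraction is the real part of a unitary in the C⋆-algebra it generates. -/
theorem exists_unitary_add_star {A : Type*} [CStarAlgebra A] {h : A} (hsa : IsSelfAdjoint h)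
    (hn : ‖h‖ ≤ 1) :
    ∃ u : unitary A, (u : A) + star (u : A) = (2 : ℂ) • h ∧
      ∀ c, Commute c h → Commute c (u : A) := by
  refine ⟨⟨_, hsa.self_add_I_smul_cfcSqrt_sub_sq_mem_unitary h hn⟩, ?_, fun c hc => ?_⟩
  · have : star (CFC.sqrt (1 - h ^ 2)) = CFC.sqrt (1 - h ^ 2) :=
      (IsSelfAdjoint.of_nonneg (CFC.sqrt_nonneg _)).star_eq
    simp only [star_add, star_smul, this, hsa.star_eq, Complex.star_def, Complex.conj_I]
    module
  · refine hc.add_right (Commute.smul_right ?_ _)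
    have h1 : Commute (1 - h ^ 2) c := (Commute.one_left c).sub_left (hc.symm.pow_left 2)
    exact (h1.cfcₙ_nnreal NNReal.sqrt).symm

end UnitaryOfSelfAdjoint

/-! ### Double commutant of a representation -/

section Bicommutant

variable {K : Type*} [NormedAddCommGroup K] [InnerProductSpace ℂ K] [CompleteSpace K]
variable {B : Type*} [CStarAlgebra B]

/-- Membership in the double commutant of a representation. -/
def InBicommutant (ρ : B →⋆ₐ[ℂ] (K →L[ℂ] K)) (y : K →L[ℂ] K) : Prop :=
  ∀ c, (∀ b, Commute c (ρ b)) → Commute c y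

variable {ρ : B →⋆ₐ[ℂ] (K →L[ℂ] K)}

theorem commute_star_rep {c : K →L[ℂ] K} (hc : ∀ b, Commute c (ρ b)) (b : B) :
    Commute (star c) (ρ b) := by
  have := (hc (star b)).star_star
  rwa [map_star, star_star] at this

theorem mem_bicommutant_iff {y : K →L[ℂ] K} : y ∈ bicommutant ρ.range ↔ InBicommutant ρ y := by
  change y ∈ StarSubalgebra.centralizer ℂ
    (StarSubalgebra.centralizer ℂ (ρ.range : Set (K →L[ℂ] K)) : Set (K →L[ℂ] K)) ↔ _
  have hmem : ∀ c, c ∈ (StarSubalgebra.centralizer ℂ (ρ.range : Set (K →L[ℂ] K)) :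
      Set (K →L[ℂ] K)) ↔ ∀ b, Commute c (ρ b) := by
    intro c
    rw [SetLike.mem_coe, StarSubalgebra.mem_centralizer_iff]
    constructor
    · intro h b
      exact (h (ρ b) ⟨b, rfl⟩).1.symm
    · rintro h _ ⟨b, rfl⟩
      refine ⟨(h b).symm.eq, ?_⟩
      have := (h (star b)).symm.eq
      rwa [map_star] at this
  rw [StarSubalgebra.mem_centralizer_iff]
  constructor
  · intro h c hc
    exact (h c ((hmem c).mpr hc)).1
  · intro h c hc
    have hc' := (hmem c).mp hc
    exact ⟨h c hc', h (star c) (commute_star_rep hc')⟩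

theorem InBicommutant.star {y : K →L[ℂ] K} (hy : InBicommutant ρ y) :
    InBicommutant ρ (star y) := fun c hc => by
  have := (hy (Star.star c) (commute_star_rep hc)).star_star
  rwa [star_star] at this

theorem InBicommutant.smul {y : K →L[ℂ] K} (hy : InBicommutant ρ y) (t : ℂ) :
    InBicommutant ρ (t • y) := fun c hc => (hy c hc).smul_right t

theorem inBicommutant_map (b : B) : InBicommutant ρ (ρ b) := fun _ hc => hc b

end Bicommutant

/-! ### Abelian projections of the right half-chain are minimal -/

section Minimal

variable {H K : Type*} [NormedAddCommGroup H] [InnerProductSpace ℂ H] [CompleteSpace H]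
  [NormedAddCommGroup K] [InnerProductSpace ℂ K] [CompleteSpace K]
  {B : Type*} [CStarAlgebra B]

/-- `ρ` is a subrepresentation, on the range of `J`, of the restriction of `π` to the right
half-chain algebra, which is identified with `B` by `i`. -/
structure IsRightSubrep (π : quasiLocal →⋆ₐ[ℂ] (H →L[ℂ] H)) (i : B →⋆ₐ[ℂ] quasiLocal)
    (ρ : B →⋆ₐ[ℂ] (K →L[ℂ] K)) (J : K →ₗᵢ[ℂ] H) : Prop where
  mem : ∀ b, i b ∈ rightAlgebra
  surj : ∀ r ∈ rightAlgebra, ∃ b, i b = r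
  intertwine : ∀ b k, J (ρ b k) = π (i b) (J k)

/-- A nonzero abelian projection in the double commutant of `ρ`. -/
structure IsAbelianProjection (ρ : B →⋆ₐ[ℂ] (K →L[ℂ] K)) (e : K →L[ℂ] K) : Prop where
  isStarProjection : IsStarProjection e
  inBicommutant : InBicommutant ρ e
  ne_zero : e ≠ 0
  abelian : ∀ x y, InBicommutant ρ x → InBicommutant ρ y → Commute (e * x * e) (e * y * e)

variable {π : quasiLocal →⋆ₐ[ℂ] (H →L[ℂ] H)} {i : B →⋆ₐ[ℂ] quasiLocal}
  {ρ : B →⋆ₐ[ℂ] (K →L[ℂ] K)} {J : K →ₗᵢ[ℂ] H} {e : K →L[ℂ] K}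

variable (J) in
/-- The compression of an operator to a subspace. -/
noncomputable def compression (T : H →L[ℂ] H) : K →L[ℂ] K :=
  J.toContinuousLinearMap.adjoint ∘L T ∘L J.toContinuousLinearMap

theorem inner_compression (T : H →L[ℂ] H) (x y : K) :
    inner ℂ x (compression J T y) = inner ℂ (J x) (T (J y)) := by
  have h := ContinuousLinearMap.adjoint_inner_right J.toContinuousLinearMap x (T (J y))
  exact h

/-- Left observables commute with right ones and `J` intertwines, so compressing them lands in the
commutant of `ρ`. This is how a left observable passes through `e` and everything else in the double
commutant. -/
theorem IsRightSubrep.compression_commute (hJ : IsRightSubrep π i ρ J) {l : quasiLocal}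
    (hl : l ∈ leftAlgebra) (b : B) : Commute (compression J (π l)) (ρ b) := by
  ext k
  refine ext_inner_left ℂ fun x => ?_
  change inner ℂ x (compression J (π l) (ρ b k)) = inner ℂ x (ρ b (compression J (π l) k))
  have h1 : inner ℂ x (ρ b (compression J (π l) k)) =
      inner ℂ (ρ (star b) x) (compression J (π l) k) := by rw [inner_map_left ρ, star_star]
  have h2 : inner ℂ (π (i (star b)) (J x)) (π l (J k)) =
      inner ℂ (J x) (π (i b) (π l (J k))) := by
    rw [inner_map_left π, ← map_star i, star_star]
  rw [h1, inner_compression, inner_compression, hJ.intertwine, hJ.intertwine, h2,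
    map_right_map_left hl (hJ.mem b)]

theorem IsRightSubrep.inner_map_map (hJ : IsRightSubrep π i ρ J) (l : quasiLocal) (b : B)
    (x y : K) :
    inner ℂ (J x) (π l (π (i b) (J y))) = inner ℂ x (compression J (π l) (ρ b y)) := by
  rw [inner_compression, hJ.intertwine]

set_option maxHeartbeats 1000000 in
/-- An abelian projection in the von Neumann algebra of the right half-chain is minimal. -/
theorem exists_smul_of_isSelfAdjoint (hπ : IsIrreducibleRep π)
    (hJ : IsRightSubrep π i ρ J) (he : IsAbelianProjection ρ e)
    {y : K →L[ℂ] K} (hy : InBicommutant ρ y) (hsa : IsSelfAdjoint y) (hn : ‖e * y * e‖ ≤ 1) :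
    ∃ c : ℂ, e * y * e = c • e := by
  have hee : e * e = e := he.isStarProjection.isIdempotentElem
  have hes : star e = e := he.isStarProjection.isSelfAdjoint
  have hhsa : IsSelfAdjoint (e * y * e) := by
    rw [IsSelfAdjoint, star_mul, star_mul, hes, hsa.star_eq, mul_assoc]
  -- Passing from `e y e` to a unitary `u` with real part `e y e` turns minimality into a statement
  -- about unitaries: `u` will preserve all correlations of vectors in the range of `e`.
  obtain ⟨u, hu, huc⟩ := exists_unitary_add_star hhsa hn
  have hue : Commute e (u : K →L[ℂ] K) := huc _ (by
    rw [Commute, SemiconjBy, mul_assoc, mul_assoc, mul_assoc, hee, ← mul_assoc e e, hee])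
  have huu : star (u : K →L[ℂ] K) * u = 1 := Unitary.star_mul_self_of_mem u.2
  have hue' : Commute e (star (u : K →L[ℂ] K)) := by
    have := hue.star_star
    rwa [hes] at this
  obtain ⟨k, hk⟩ : ∃ k, e k ≠ 0 := by
    by_contra! hcon
    exact he.ne_zero (ContinuousLinearMap.ext hcon)
  have huk : (u : K →L[ℂ] K) (e k) ≠ 0 := fun h0 => hk (by
    have := DFunLike.congr_fun huu (e k)
    change star (u : K →L[ℂ] K) ((u : K →L[ℂ] K) (e k)) = e k at this
    rw [← this, h0, map_zero])
  -- At angle `0` an implementer commutes with all observables, so it is a scalar `c`. Since it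
  -- sends `J (e k)` to `J (u (e k))`, this yields `u e = c e`.
  obtain ⟨U, hU, hUv⟩ := hπ.exists_implements 0 (v := fun k => J (e k))
    (w := fun k => J ((u : K →L[ℂ] K) (e k))) ⟨k, (map_ne_zero_iff _ J.injective).mpr hk⟩
    ⟨k, (map_ne_zero_iff _ J.injective).mpr huk⟩ <| by
    intro x x' l hl r hr
    obtain ⟨b, rfl⟩ := hJ.surj r hr
    rw [gauge_zero, hJ.inner_map_map, hJ.inner_map_map]
    set c := compression J (π l)
    have hc : ∀ b, Commute c (ρ b) := hJ.compression_commute hl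
    have hce : Commute c e := he.inBicommutant c hc
    have hcu : Commute c (u : K →L[ℂ] K) :=
      huc c ((hce.mul_right (hy c hc)).mul_right hce)
    -- The only use of abelianness: `e ρ(b) e` commutes with `e y e`, hence with `u`.
    have hru := huc _ (he.abelian _ _ (inBicommutant_map (ρ := ρ) b) hy)
    generalize ρ b = q at *
    have key : star ((u : K →L[ℂ] K) * e) * (c * q * (u * e)) = star e * (c * q * e) := by
      rw [star_mul, hes]
      calc e * star (u : K →L[ℂ] K) * (c * q * (u * e))
          = star (u : K →L[ℂ] K) * (e * c) * q * (e * u) := by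
            rw [hue'.eq, hue.eq]; simp only [mul_assoc]
        _ = star (u : K →L[ℂ] K) * c * ((e * q * e) * u) := by
            rw [← hce.eq]; simp only [mul_assoc]
        _ = star (u : K →L[ℂ] K) * (c * u) * (e * q * e) := by
            rw [hru.eq]; simp only [mul_assoc]
        _ = (star (u : K →L[ℂ] K) * u) * (c * e) * q * e := by
            rw [hcu.eq]; simp only [mul_assoc]
        _ = e * (c * q * e) := by
            rw [huu, hce.eq]; simp only [mul_assoc, one_mul]
    have h1 := congrArg (fun T : K →L[ℂ] K => inner ℂ x (T x')) key
    simp only [ContinuousLinearMap.star_eq_adjoint] at h1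
    change inner ℂ x ((((u : K →L[ℂ] K) * e).adjoint) (c (q ((u : K →L[ℂ] K) (e x'))))) =
      inner ℂ x (e.adjoint (c (q (e x')))) at h1
    rw [ContinuousLinearMap.adjoint_inner_right, ContinuousLinearMap.adjoint_inner_right] at h1
    exact h1
  obtain ⟨c, hc⟩ := hπ U fun j Q => by
    rcases le_or_gt j 0 with hj | hj
    · exact hU.1 j hj Q
    · have := hU.2 j hj Q
      rwa [gauge_zero] at this
  have huec : (u : K →L[ℂ] K) * e = c • e := by
    ext x
    apply J.injective
    have := hUv 1 (one_mem _) 1 (one_mem _) x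
    rw [gauge_zero, hc] at this
    simp only [_root_.map_one, one_apply_eq_self, smul_apply] at this
    change J ((u : K →L[ℂ] K) (e x)) = J (c • e x)
    rw [map_smul, this]
  -- With `u e = c e` and `u* e = c⁻¹ e`, the identity `2 e y e = u + u*` multiplied by `e` gives
  -- the scalar `(c + c⁻¹) / 2`.
  have hue2 : star (u : K →L[ℂ] K) * e = c⁻¹ • e := by
    have h1 : e = c • (star (u : K →L[ℂ] K) * e) := by
      rw [← mul_smul_comm, ← huec, ← mul_assoc, huu, one_mul]
    have hc0 : c ≠ 0 := by
      rintro rfl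
      rw [zero_smul] at h1
      exact he.ne_zero h1
    rw [eq_inv_smul_iff₀ hc0, ← h1]
  refine ⟨2⁻¹ * (c + c⁻¹), ?_⟩
  have h2 : (2 : ℂ) • (e * y * e) = (c + c⁻¹) • e := by
    have : (2 : ℂ) • (e * y * e) = ((2 : ℂ) • (e * y * e)) * e := by
      rw [smul_mul_assoc, mul_assoc _ e e, hee]
    rw [this, ← hu, add_mul, huec, hue2, add_smul]
  rw [mul_smul, ← h2, smul_smul]
  norm_num

/-- The self-adjoint contraction case extends by rescaling and then by splitting into real and
imaginary parts, both of which stay in the double commutant. -/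
theorem exists_smul_of_inBicommutant (hπ : IsIrreducibleRep π)
    (hJ : IsRightSubrep π i ρ J) (he : IsAbelianProjection ρ e)
    {y : K →L[ℂ] K} (hy : InBicommutant ρ y) : ∃ c : ℂ, e * y * e = c • e := by
  have hsa : ∀ y, InBicommutant ρ y → IsSelfAdjoint y → ∃ c : ℂ, e * y * e = c • e := by
    intro y hy hys
    set t : ℝ := (‖e * y * e‖ + 1)⁻¹ with ht
    have ht0 : 0 < t := by positivity
    obtain ⟨c, hc⟩ := exists_smul_of_isSelfAdjoint hπ hJ he (hy.smul (t : ℂ))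
      (by rw [IsSelfAdjoint, star_smul, hys.star_eq]; simp) (by
        rw [mul_smul_comm, smul_mul_assoc, norm_smul, Complex.norm_real, Real.norm_of_nonneg ht0.le,
          ht, inv_mul_le_iff₀ (by positivity)]
        linarith)
    refine ⟨(t : ℂ)⁻¹ * c, ?_⟩
    have ht0' : (t : ℂ) ≠ 0 := by exact_mod_cast ht0.ne'
    rw [mul_smul, ← hc, mul_smul_comm, smul_mul_assoc, inv_smul_smul₀ ht0']
  obtain ⟨c, hc⟩ := hsa (ℜ y) (fun d hd => by
    rw [realPart_apply_coe]
    exact ((hy d hd).add_right (hy.star d hd)).smul_right _) (ℜ y).2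
  obtain ⟨d, hd⟩ := hsa (ℑ y) (fun d hd => by
    rw [imaginaryPart_apply_coe]
    exact (((hy d hd).sub_right (hy.star d hd)).smul_right _).smul_right _) (ℑ y).2
  refine ⟨c + Complex.I * d, ?_⟩
  conv_lhs => rw [← realPart_add_I_smul_imaginaryPart y]
  rw [mul_add, add_mul, hc, mul_smul_comm, smul_mul_assoc, hd]
  module

end Minimal

/-! ### From a rotated minimal projection to a half-chain implementer -/

section GaugeImplementers

variable {H K : Type*} [NormedAddCommGroup H] [InnerProductSpace ℂ H] [CompleteSpace H]
  [NormedAddCommGroup K] [InnerProductSpace ℂ K] [CompleteSpace K]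
  {B : Type*} [CStarAlgebra B]
  {π : quasiLocal →⋆ₐ[ℂ] (H →L[ℂ] H)} {i : B →⋆ₐ[ℂ] quasiLocal}
  {ρ : B →⋆ₐ[ℂ] (K →L[ℂ] K)} {J : K →ₗᵢ[ℂ] H} {e : K →L[ℂ] K}

theorem norm_unitary_apply (U : unitary (H →L[ℂ] H)) (x : H) : ‖(U : H →L[ℂ] H) x‖ = ‖x‖ :=
  (Unitary.linearIsometryEquiv U).norm_map x

variable (i ρ) in
/-- `W` implements the gauge rotation by `θ` in the representation `ρ` of the right half-chain. -/
def ImplementsRight (θ : ℝ) (W : K →L[ℂ] K) : Prop :=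
  ∀ b b', i b' = gauge θ (i b) → W * ρ b = ρ b' * W

theorem IsRightSubrep.exists_gauge (hJ : IsRightSubrep π i ρ J) (θ : ℝ) (b : B) :
    ∃ b', i b' = gauge θ (i b) := hJ.surj _ (gauge_mem θ (hJ.mem b))

theorem mul_star_comm_of_unitary {W : unitary (K →L[ℂ] K)} {x y : K →L[ℂ] K}
    (h : (W : K →L[ℂ] K) * x = y * W) :
    x * star (W : K →L[ℂ] K) = star (W : K →L[ℂ] K) * y := by
  have h1 : star (W : K →L[ℂ] K) * W = 1 := Unitary.star_mul_self_of_mem W.2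
  have h2 : (W : K →L[ℂ] K) * star (W : K →L[ℂ] K) = 1 := Unitary.mul_star_self_of_mem W.2
  calc x * star (W : K →L[ℂ] K) = star (W : K →L[ℂ] K) * (W * x) * star (W : K →L[ℂ] K) := by
        rw [← mul_assoc, h1, one_mul]
    _ = star (W : K →L[ℂ] K) * y := by rw [h, mul_assoc, mul_assoc, h2, mul_one]

/-- The rotated projection lies in the double commutant. -/
theorem IsRightSubrep.inBicommutant_conj (hJ : IsRightSubrep π i ρ J) {θ : ℝ}
    {W : unitary (K →L[ℂ] K)} (hW : ImplementsRight i ρ θ W) {y : K →L[ℂ] K}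
    (hy : InBicommutant ρ y) :
    InBicommutant ρ ((W : K →L[ℂ] K) * y * star (W : K →L[ℂ] K)) := by
  intro c hc
  have h1 : star (W : K →L[ℂ] K) * W = 1 := Unitary.star_mul_self_of_mem W.2
  have h2 : (W : K →L[ℂ] K) * star (W : K →L[ℂ] K) = 1 := Unitary.mul_star_self_of_mem W.2
  -- `W` permutes the represented observables, so conjugation by it preserves the commutant.
  have h3 : Commute (star (W : K →L[ℂ] K) * c * W) y := hy _ fun b => by
    obtain ⟨b', hb'⟩ := hJ.exists_gauge θ b
    have h4 := hW b b' hb'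
    have h5 := mul_star_comm_of_unitary h4
    change star (W : K →L[ℂ] K) * c * W * ρ b = ρ b * (star (W : K →L[ℂ] K) * c * W)
    rw [mul_assoc, h4, mul_assoc, ← mul_assoc c, (hc b').eq, ← mul_assoc, ← mul_assoc, ← h5]
    simp only [mul_assoc]
  have h6 := h3.eq
  change c * ((W : K →L[ℂ] K) * y * star (W : K →L[ℂ] K)) =
    (W : K →L[ℂ] K) * y * star (W : K →L[ℂ] K) * c
  calc c * ((W : K →L[ℂ] K) * y * star (W : K →L[ℂ] K))
      = ((W : K →L[ℂ] K) * star (W : K →L[ℂ] K)) * c * W * y * star (W : K →L[ℂ] K) := by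
        rw [h2, one_mul]; simp only [mul_assoc]
    _ = (W : K →L[ℂ] K) * (star (W : K →L[ℂ] K) * c * W * y) * star (W : K →L[ℂ] K) := by
        simp only [mul_assoc]
    _ = (W : K →L[ℂ] K) * y * star (W : K →L[ℂ] K) * c *
          ((W : K →L[ℂ] K) * star (W : K →L[ℂ] K)) := by
        rw [h6]; simp only [mul_assoc]
    _ = _ := by rw [h2, mul_one]

set_option maxHeartbeats 1000000 in
/-- The gauge rotations that do not move the range of a minimal projection to its orthogonal
complement are implemented by unitaries of the right half-chain. -/
theorem exists_implements_of_conj_ne_zero (hπ : IsIrreducibleRep π) (hJ : IsRightSubrep π i ρ J)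
    (he : IsAbelianProjection ρ e) {θ : ℝ} {W : unitary (K →L[ℂ] K)}
    (hW : ImplementsRight i ρ θ W) {ξ : K} (hξ : e ξ = ξ)
    (h0 : ((W : K →L[ℂ] K) * e * star (W : K →L[ℂ] K)) ξ ≠ 0) :
    ∃ U : unitary (H →L[ℂ] H), Implements π θ U ∧ ∀ l ∈ leftAlgebra, ∀ r ∈ rightAlgebra,
      (U : H →L[ℂ] H) (π l (π r (J ξ))) = π l (π (gauge θ r)
        (((‖ξ‖ / ‖((W : K →L[ℂ] K) * e * star (W : K →L[ℂ] K)) ξ‖ : ℝ) : ℂ) •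
          J (((W : K →L[ℂ] K) * e * star (W : K →L[ℂ] K)) ξ))) := by
  have hee : e * e = e := he.isStarProjection.isIdempotentElem
  have hes : star e = e := he.isStarProjection.isSelfAdjoint
  have h1 : star (W : K →L[ℂ] K) * W = 1 := Unitary.star_mul_self_of_mem W.2
  have hfb := hJ.inBicommutant_conj hW he.inBicommutant
  have hfs : star ((W : K →L[ℂ] K) * e * star (W : K →L[ℂ] K)) =
      (W : K →L[ℂ] K) * e * star (W : K →L[ℂ] K) := by
    rw [star_mul, star_mul, star_star, hes, mul_assoc]
  have hff : ((W : K →L[ℂ] K) * e * star (W : K →L[ℂ] K)) *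
      ((W : K →L[ℂ] K) * e * star (W : K →L[ℂ] K)) =
      (W : K →L[ℂ] K) * e * star (W : K →L[ℂ] K) := by
    calc _ = (W : K →L[ℂ] K) * e * (star (W : K →L[ℂ] K) * W) * e * star (W : K →L[ℂ] K) := by
          simp only [mul_assoc]
      _ = _ := by rw [h1, mul_one, mul_assoc (W : K →L[ℂ] K), hee]
  have hfρ : ∀ b b' c, i b' = gauge θ (i b) → e * ρ b * e = c • e →
      ((W : K →L[ℂ] K) * e * star (W : K →L[ℂ] K)) * ρ b' *
        ((W : K →L[ℂ] K) * e * star (W : K →L[ℂ] K)) =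
      (c : ℂ) • ((W : K →L[ℂ] K) * e * star (W : K →L[ℂ] K)) := by
    intro b b' c hb hc
    calc _ = (W : K →L[ℂ] K) * e * (star (W : K →L[ℂ] K) * ρ b') * W * e *
          star (W : K →L[ℂ] K) := by simp only [mul_assoc]
      _ = (W : K →L[ℂ] K) * e * ρ b * (star (W : K →L[ℂ] K) * W) * e * star (W : K →L[ℂ] K) := by
          rw [← mul_star_comm_of_unitary (hW b b' hb)]; simp only [mul_assoc]
      _ = (W : K →L[ℂ] K) * (e * ρ b * e) * star (W : K →L[ℂ] K) := by
          rw [h1, mul_one]; simp only [mul_assoc]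
      _ = _ := by rw [hc, mul_smul_comm, smul_mul_assoc]
  set f := (W : K →L[ℂ] K) * e * star (W : K →L[ℂ] K) with hf
  have hadj : ∀ {T : K →L[ℂ] K}, star T = T → ∀ x y, inner ℂ (T x) y = inner ℂ x (T y) := by
    intro T hT x y
    conv_lhs => rw [← hT]
    rw [ContinuousLinearMap.star_eq_adjoint, ContinuousLinearMap.adjoint_inner_left]
  have hξ0 : ξ ≠ 0 := by
    rintro rfl
    exact h0 (map_zero _)
  -- Minimality of `e` applied to the rotated projection `f` gives `e f e = d e`, and evaluating on
  -- `ξ` identifies `d` as `‖f ξ‖² / ‖ξ‖²`. This is the factor that the normalization of `J (f ξ)`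
  -- must cancel.
  obtain ⟨d, hd⟩ := exists_smul_of_inBicommutant hπ hJ he hfb
  have hefe : e (f ξ) = d • ξ := by
    have := DFunLike.congr_fun hd ξ
    change e (f (e ξ)) = d • e ξ at this
    rwa [hξ] at this
  have hdn : d * (‖ξ‖ : ℂ) ^ 2 = (‖f ξ‖ : ℂ) ^ 2 := by
    have h2 : inner ℂ (f ξ) (f ξ) = inner ℂ ξ (e (f ξ)) := by
      rw [hadj hfs, ← hadj hes, hξ]
      exact congrArg (inner ℂ ξ) (DFunLike.congr_fun hff ξ)
    rw [hefe, inner_smul_right, inner_self_eq_norm_sq_to_K, inner_self_eq_norm_sq_to_K] at h2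
    exact h2.symm
  have hn0 : (‖f ξ‖ : ℂ) ≠ 0 := by exact_mod_cast norm_ne_zero_iff.mpr h0
  have hn1 : (‖ξ‖ : ℂ) ≠ 0 := by exact_mod_cast norm_ne_zero_iff.mpr hξ0
  obtain ⟨U, hU, hUv⟩ := hπ.exists_implements θ (ι := Unit) (v := fun _ => J ξ)
    (w := fun _ => ((‖ξ‖ / ‖f ξ‖ : ℝ) : ℂ) • J (f ξ))
    ⟨(), (map_ne_zero_iff _ J.injective).mpr hξ0⟩
    ⟨(), smul_ne_zero (by push_cast; exact div_ne_zero hn1 hn0)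
      ((map_ne_zero_iff _ J.injective).mpr h0)⟩ <| by
    rintro - - l hl r hr
    obtain ⟨b, rfl⟩ := hJ.surj r hr
    obtain ⟨b', hb'⟩ := hJ.exists_gauge θ b
    rw [← hb']
    simp only [map_smul, inner_smul_left, inner_smul_right, Complex.conj_ofReal]
    rw [hJ.inner_map_map, hJ.inner_map_map]
    set c := compression J (π l)
    have hc : ∀ b, Commute c (ρ b) := hJ.compression_commute hl
    have hce : ∀ x, c (e x) = e (c x) := DFunLike.congr_fun (he.inBicommutant c hc).eq
    have hcf : ∀ x, c (f x) = f (c x) := DFunLike.congr_fun (hfb c hc).eq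
    have hcρ : ∀ b x, c (ρ b x) = ρ b (c x) := fun b => DFunLike.congr_fun (hc b).eq
    obtain ⟨ω, hω⟩ := exists_smul_of_inBicommutant hπ hJ he (inBicommutant_map (ρ := ρ) b)
    have hfω := hfρ b b' ω hb' hω
    have hω1 : ∀ x, e (ρ b (e x)) = ω • e x := DFunLike.congr_fun hω
    have hω2 : ∀ x, f (ρ b' (f x)) = ω • f x := DFunLike.congr_fun hfω
    -- Minimality makes right observables scalars between `e` on one side and, after rotation,
    -- between `f` on the other, with the same `ω`. What remains is the compressed left observable
    -- `c`, which sees `f ξ` only through `e (f ξ) = d ξ`.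
    have hL : inner ℂ (f ξ) (c (ρ b' (f ξ))) = ω * (d * inner ℂ ξ (c ξ)) := by
      rw [hadj hfs, ← hcf, hω2, map_smul, inner_smul_right]
      congr 1
      conv_lhs => rw [← hξ, hadj hes, hξ, ← hce, hefe, map_smul, inner_smul_right]
    have hR : inner ℂ ξ (c (ρ b ξ)) = ω * inner ℂ ξ (c ξ) := by
      conv_lhs => rw [← hξ, hadj hes, ← hce, hω1, hξ, map_smul, inner_smul_right]
    rw [hL, hR]
    have hd' : d = (‖f ξ‖ : ℂ) ^ 2 / (‖ξ‖ : ℂ) ^ 2 := by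
      rw [eq_div_iff (pow_ne_zero 2 hn1), hdn]
    rw [hd']
    push_cast
    field_simp
  exact ⟨U, hU, fun l hl r hr => hUv l hl r hr ()⟩

end GaugeImplementers

/-! ### Strong continuity of the implementers at angle zero -/

section GaugeContinuity

variable {H K : Type*} [NormedAddCommGroup H] [InnerProductSpace ℂ H] [CompleteSpace H]
  [NormedAddCommGroup K] [InnerProductSpace ℂ K] [CompleteSpace K]
  {B : Type*} [CStarAlgebra B]
  {π : quasiLocal →⋆ₐ[ℂ] (H →L[ℂ] H)} {i : B →⋆ₐ[ℂ] quasiLocal}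
  {ρ : B →⋆ₐ[ℂ] (K →L[ℂ] K)} {J : K →ₗᵢ[ℂ] H} {e : K →L[ℂ] K}

theorem tendsto_clm_apply {H α : Type*} {l : Filter α} [NormedAddCommGroup H]
    [InnerProductSpace ℂ H] {T : α → H →L[ℂ] H} {T₀ : H →L[ℂ] H}
    {x : α → H} {x₀ : H} (hT : Filter.Tendsto T l (nhds T₀)) (hx : Filter.Tendsto x l (nhds x₀)) :
    Filter.Tendsto (fun a => T a (x a)) l (nhds (T₀ x₀)) :=
  ((isBoundedBilinearMap_apply (𝕜 := ℂ) (E := H) (F := H)).continuous.tendsto (T₀, x₀)).comp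
    (hT.prodMk_nhds hx)

theorem norm_star_unitary_sub (W : unitary (K →L[ℂ] K)) (x : K) :
    ‖star (W : K →L[ℂ] K) x - x‖ = ‖(W : K →L[ℂ] K) x - x‖ := by
  have h2 : (W : K →L[ℂ] K) (star (W : K →L[ℂ] K) x) = x :=
    DFunLike.congr_fun (Unitary.mul_star_self_of_mem W.2) x
  rw [← norm_unitary_apply W, map_sub, h2, norm_sub_rev]

/-- Write `W e W* ξ - ξ` as `W e (W* ξ - ξ) + (W ξ - ξ)`. Unitarity gives `‖W* ξ - ξ‖ = ‖W ξ - ξ‖`,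
so strong convergence of `W` alone suffices. -/
theorem tendsto_conj_apply {α : Type*} {l : Filter α} {W : α → unitary (K →L[ℂ] K)}
    (hW : ∀ k, Filter.Tendsto (fun a => (W a : K →L[ℂ] K) k) l (nhds k)) {ξ : K} (hξ : e ξ = ξ) :
    Filter.Tendsto (fun a => ((W a : K →L[ℂ] K) * e * star (W a : K →L[ℂ] K)) ξ) l (nhds ξ) := by
  have h1 : Filter.Tendsto (fun a => ‖(W a : K →L[ℂ] K) ξ - ξ‖) l (nhds 0) := by
    simpa using ((hW ξ).sub_const ξ).norm
  rw [tendsto_iff_norm_sub_tendsto_zero]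
  refine squeeze_zero (fun _ => norm_nonneg _) (fun a => ?_)
    (by simpa using (h1.const_mul ‖e‖).add h1)
  have h2 : ((W a : K →L[ℂ] K) * e * star (W a : K →L[ℂ] K)) ξ - ξ =
      (W a : K →L[ℂ] K) (e (star (W a : K →L[ℂ] K) ξ - ξ)) + ((W a : K →L[ℂ] K) ξ - ξ) := by
    rw [map_sub, hξ, map_sub]
    change (W a : K →L[ℂ] K) (e (star (W a : K →L[ℂ] K) ξ)) - ξ = _
    abel
  rw [h2]
  refine (norm_add_le _ _).trans (add_le_add_left ?_ _)
  rw [norm_unitary_apply, ← norm_star_unitary_sub]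
  exact e.le_opNorm _

/-- Small gauge rotations of the right half-chain are implemented by unitaries that tend strongly
to the identity. -/
theorem exists_implements_tendsto (hπ : IsIrreducibleRep π) (hJ : IsRightSubrep π i ρ J)
    (he : IsAbelianProjection ρ e) {W : ℝ → unitary (K →L[ℂ] K)}
    (hW : ∀ θ, ImplementsRight i ρ θ (W θ))
    (hWc : ∀ k, Filter.Tendsto (fun θ => (W θ : K →L[ℂ] K) k) (nhds 0) (nhds k)) :
    ∃ U : ℝ → unitary (H →L[ℂ] H), (∀ᶠ θ in nhds 0, Implements π θ (U θ)) ∧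
      ∀ x, Filter.Tendsto (fun θ => (U θ : H →L[ℂ] H) x) (nhds 0) (nhds x) := by
  obtain ⟨k, hk⟩ : ∃ k, e k ≠ 0 := by
    by_contra! hcon
    exact he.ne_zero (ContinuousLinearMap.ext hcon)
  obtain ⟨ξ, hξ, hξ0⟩ : ∃ ξ, e ξ = ξ ∧ ξ ≠ 0 :=
    ⟨e k, DFunLike.congr_fun he.isStarProjection.isIdempotentElem.eq k, hk⟩
  have hlim := tendsto_conj_apply hWc hξ
  set f : ℝ → K := fun θ => ((W θ : K →L[ℂ] K) * e * star (W θ : K →L[ℂ] K)) ξ with hf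
  have hf0 : ∀ᶠ θ in nhds 0, f θ ≠ 0 := hlim.eventually_ne hξ0
  have hex : ∀ θ, ∃ U : unitary (H →L[ℂ] H), f θ ≠ 0 → Implements π θ U ∧
      ∀ l ∈ leftAlgebra, ∀ r ∈ rightAlgebra, (U : H →L[ℂ] H) (π l (π r (J ξ))) =
        π l (π (gauge θ r) (((‖ξ‖ / ‖f θ‖ : ℝ) : ℂ) • J (f θ))) := by
    intro θ
    by_cases h : f θ ≠ 0
    · obtain ⟨U, hU⟩ := exists_implements_of_conj_ne_zero hπ hJ he (hW θ) hξ h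
      exact ⟨U, fun _ => hU⟩
    · exact ⟨1, fun h' => absurd h' h⟩
  choose U hU using hex
  refine ⟨U, hf0.mono fun θ hθ => (hU θ hθ).1, ?_⟩
  refine tendsto_of_total (fun θ => (U θ : H →L[ℂ] H))
    (fun θ x => (norm_unitary_apply (U θ) x).le)
    (hπ.dense_orbit (v := fun _ : Unit => J ξ) ⟨(), (map_ne_zero_iff _ J.injective).mpr hξ0⟩) ?_
  rintro ⟨⟨l, hl⟩, ⟨r, hr⟩, -⟩
  change Filter.Tendsto (fun θ => (U θ : H →L[ℂ] H) (π l (π r (J ξ)))) (nhds 0)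
    (nhds (π l (π r (J ξ))))
  have hev : (fun θ => π l (π (gauge θ r) (((‖ξ‖ / ‖f θ‖ : ℝ) : ℂ) • J (f θ)))) =ᶠ[nhds 0]
      fun θ => (U θ : H →L[ℂ] H) (π l (π r (J ξ))) :=
    hf0.mono fun θ hθ => ((hU θ hθ).2 l hl r hr).symm
  refine Filter.Tendsto.congr' hev ?_
  refine ((π l).continuous.tendsto _).comp ?_
  have h1 : Filter.Tendsto (fun θ => π (gauge θ r)) (nhds 0) (nhds (π r)) :=
    ((map_continuous π).tendsto _).comp (tendsto_gauge r)
  refine tendsto_clm_apply h1 ?_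
  have h2 : Filter.Tendsto (fun θ => ((‖ξ‖ / ‖f θ‖ : ℝ) : ℂ)) (nhds 0) (nhds 1) := by
    have h3 : Filter.Tendsto (fun θ => ‖ξ‖ / ‖f θ‖) (nhds 0) (nhds (‖ξ‖ / ‖ξ‖)) :=
      tendsto_const_nhds.div hlim.norm (norm_ne_zero_iff.mpr hξ0)
    rw [div_self (norm_ne_zero_iff.mpr hξ0)] at h3
    have := (Complex.continuous_ofReal.tendsto (1 : ℝ)).comp h3
    rwa [Complex.ofReal_one] at this
  have h4 := h2.smul ((J.continuous.tendsto ξ).comp hlim)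
  rw [one_smul] at h4
  exact h4

set_option maxHeartbeats 1000000 in
/-- The gauge action is implemented in the GNS representation of an invariant state. -/
theorem exists_implementsRight (ψ : State B) (hi : Isometry i) (hmem : ∀ b, i b ∈ rightAlgebra)
    (hsurj : ∀ r ∈ rightAlgebra, ∃ b, i b = r)
    (hinv : ∀ θ b b', i b' = gauge θ (i b) → ψ b' = ψ b) :
    ∃ W : ℝ → unitary (ψ.GNSSpace →L[ℂ] ψ.GNSSpace),
      (∀ θ, ImplementsRight i ψ.gnsRep θ (W θ)) ∧
      ∀ k, Filter.Tendsto (fun θ => (W θ : ψ.GNSSpace →L[ℂ] ψ.GNSSpace) k) (nhds 0) (nhds k) := by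
  have hex : ∀ θ b, ∃ b', i b' = gauge θ (i b) := fun θ b => hsurj _ (gauge_mem θ (hmem b))
  choose β hβ using hex
  have hβi : ∀ θ b b', i b' = gauge θ (i b) → β θ b = b' := fun θ b b' h =>
    hi.injective (by rw [hβ, h])
  have hW : ∀ θ, ∃ W : unitary (ψ.GNSSpace →L[ℂ] ψ.GNSSpace),
      ∀ b, (W : ψ.GNSSpace →L[ℂ] ψ.GNSSpace) (ψ.gnsRep b ψ.cyclicVector) =
        ψ.gnsRep (β θ b) ψ.cyclicVector := by
    intro θ
    refine exists_unitary_of_inner_eq _ (fun b => ψ.gnsRep (β θ b) ψ.cyclicVector)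
      ψ.dense_gnsRep ?_ fun a b => ?_
    · refine ψ.dense_gnsRep.mono (Submodule.span_mono ?_)
      rintro _ ⟨b, rfl⟩
      refine ⟨β (-θ) b, ?_⟩
      have : β θ (β (-θ) b) = b := hβi _ _ _ (by rw [hβ, gauge_gauge, add_neg_cancel, gauge_zero])
      simp only [this]
    · rw [ψ.inner_gnsRep, ψ.inner_gnsRep]
      refine hinv θ _ _ ?_
      rw [map_mul, map_star, hβ, hβ, map_mul i, map_star i, map_mul (gauge θ), map_star (gauge θ)]
  choose W hW using hW
  refine ⟨W, fun θ b b' hb => ?_, ?_⟩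
  · refine eq_of_eqOn_total ψ.dense_gnsRep fun a => ?_
    change (W θ : ψ.GNSSpace →L[ℂ] ψ.GNSSpace) (ψ.gnsRep b (ψ.gnsRep a ψ.cyclicVector)) =
      ψ.gnsRep b' ((W θ : ψ.GNSSpace →L[ℂ] ψ.GNSSpace) (ψ.gnsRep a ψ.cyclicVector))
    have hmul : ∀ a b, ψ.gnsRep a (ψ.gnsRep b ψ.cyclicVector) =
        ψ.gnsRep (a * b) ψ.cyclicVector := fun a b => by rw [map_mul]; rfl
    rw [hmul, hW, hW, hmul, hβi θ (b * a) (b' * β θ a)]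
    rw [map_mul, hb, hβ, map_mul i, map_mul (gauge θ)]
  · refine tendsto_of_total (fun θ => (W θ : ψ.GNSSpace →L[ℂ] ψ.GNSSpace))
      (fun θ x => (norm_unitary_apply (W θ) x).le) ψ.dense_gnsRep fun b => ?_
    simp only [hW]
    have h1 : Filter.Tendsto (fun θ => β θ b) (nhds 0) (nhds b) := by
      rw [hi.isEmbedding.tendsto_nhds_iff]
      refine (tendsto_gauge (i b)).congr fun θ => ?_
      simp [hβ]
    have h2 : Filter.Tendsto (fun θ => ψ.gnsRep (β θ b)) (nhds 0) (nhds (ψ.gnsRep b)) :=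
      ((map_continuous ψ.gnsRep).tendsto _).comp h1
    exact tendsto_clm_apply h2 tendsto_const_nhds

end GaugeContinuity

/-! ### Application to the GNS data of a state -/

section Concrete

/-- An automorphism is implemented in the GNS representation of an invariant state. -/
theorem State.exists_unitary_of_invariant {A : Type*} [CStarAlgebra A] {φ : State A}
    (σ : A ≃⋆ₐ[ℂ] A) (hσ : ∀ a, φ (σ a) = φ a) :
    ∃ T : unitary (φ.GNSSpace →L[ℂ] φ.GNSSpace),
      (T : φ.GNSSpace →L[ℂ] φ.GNSSpace) φ.cyclicVector = φ.cyclicVector ∧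
      ∀ a, (T : φ.GNSSpace →L[ℂ] φ.GNSSpace) * φ.gnsRep a = φ.gnsRep (σ a) * T := by
  obtain ⟨T, hT⟩ := exists_unitary_of_inner_eq _
    (fun a => φ.gnsRep (σ a) φ.cyclicVector) φ.dense_gnsRep (by
      refine φ.dense_gnsRep.mono (Submodule.span_mono ?_)
      rintro _ ⟨a, rfl⟩
      exact ⟨σ.symm a, by simp⟩) fun a b => by
      rw [φ.inner_gnsRep, φ.inner_gnsRep, ← map_star σ, ← map_mul σ, hσ]
  refine ⟨T, by simpa using hT 1, fun a => ?_⟩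
  refine eq_of_eqOn_total φ.dense_gnsRep fun b => ?_
  change (T : φ.GNSSpace →L[ℂ] φ.GNSSpace) (φ.gnsRep a (φ.gnsRep b φ.cyclicVector)) =
    φ.gnsRep (σ a) ((T : φ.GNSSpace →L[ℂ] φ.GNSSpace) (φ.gnsRep b φ.cyclicVector))
  have hmul : ∀ a b, φ.gnsRep a (φ.gnsRep b φ.cyclicVector) =
      φ.gnsRep (a * b) φ.cyclicVector := fun a b => by rw [map_mul]; rfl
  rw [hmul, hT, hT, hmul, map_mul σ]

/-- The GNS space of a restricted state embeds isometrically. -/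
theorem State.exists_isometry_restrict {A : Type*} [CStarAlgebra A] (φ : State A)
    (B : StarSubalgebra ℂ A) [IsClosed (B : Set A)] :
    ∃ J : (φ.restrict B).GNSSpace →ₗᵢ[ℂ] φ.GNSSpace,
      ∀ b k, J ((φ.restrict B).gnsRep b k) = φ.gnsRep b (J k) := by
  obtain ⟨J, hJ⟩ := exists_linearIsometry_of_inner_eq
    (fun b => (φ.restrict B).gnsRep b (φ.restrict B).cyclicVector)
    (fun b : B => φ.gnsRep b φ.cyclicVector)
    (φ.restrict B).dense_gnsRep fun a b => by
      rw [State.inner_gnsRep, State.inner_gnsRep]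
      rfl
  refine ⟨J, fun b k => ?_⟩
  have : J.toContinuousLinearMap ∘L (φ.restrict B).gnsRep b =
      φ.gnsRep b ∘L J.toContinuousLinearMap := by
    refine eq_of_eqOn_total (φ.restrict B).dense_gnsRep fun a => ?_
    change J ((φ.restrict B).gnsRep b ((φ.restrict B).gnsRep a
      (φ.restrict B).cyclicVector)) = φ.gnsRep b
        (J ((φ.restrict B).gnsRep a (φ.restrict B).cyclicVector))
    have h1 : (φ.restrict B).gnsRep b ((φ.restrict B).gnsRep a
        (φ.restrict B).cyclicVector) =
        (φ.restrict B).gnsRep (b * a) (φ.restrict B).cyclicVector := by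
      rw [map_mul]; rfl
    rw [h1, hJ, hJ, show ((b * a : B) : A) = b * a from rfl, map_mul]
    rfl
  exact DFunLike.congr_fun this k
theorem State.IsTypeIRep.exists_isAbelianProjection {A : Type*} [CStarAlgebra A] {ψ : State A}
    (h : ψ.IsTypeIRep) : ∃ e, IsAbelianProjection ψ.gnsRep e := by
  obtain ⟨e, he, heM, he0, -, hab⟩ := h 1 (IsStarProjection.one _) (one_mem _) (one_mem _) (by
    intro h0
    have h1 := DFunLike.congr_fun h0 ψ.cyclicVector
    rw [one_apply_eq_self, zero_apply] at h1
    have h2 := ψ.norm_cyclicVector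
    rw [h1, norm_zero] at h2
    exact zero_ne_one h2)
  exact ⟨e, he, mem_bicommutant_iff.mp heM, he0, fun x y hx hy =>
    hab x (mem_bicommutant_iff.mpr hx) y (mem_bicommutant_iff.mpr hy)⟩

variable {φ : State quasiLocal}

theorem isRightSubrep_restrict {J : (φ.restrict rightAlgebra).GNSSpace →ₗᵢ[ℂ] φ.GNSSpace}
    (hJ : ∀ b k, J ((φ.restrict rightAlgebra).gnsRep b k) = φ.gnsRep b (J k)) :
    IsRightSubrep φ.gnsRep rightAlgebra.subtype (φ.restrict rightAlgebra).gnsRep J := by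
  refine ⟨fun b => b.2, fun r hr => ⟨⟨r, hr⟩, rfl⟩, ?_⟩
  exact hJ

theorem restrict_eq_of_gauge (hgauge : ∀ (θ : ℝ) (a : quasiLocal), φ (gauge θ a) = φ a) (θ : ℝ)
    (b b' : rightAlgebra) (hb : rightAlgebra.subtype b' = gauge θ (rightAlgebra.subtype b)) :
    φ.restrict rightAlgebra b' = φ.restrict rightAlgebra b := by
  change φ (b' : quasiLocal) = φ (b : quasiLocal)
  have hb' : (b' : quasiLocal) = gauge θ b := hb
  rw [hb', hgauge]

theorem exists_implementsRight_restrict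
    (hgauge : ∀ (θ : ℝ) (a : quasiLocal), φ (gauge θ a) = φ a) :
    ∃ W : ℝ → unitary
        ((φ.restrict rightAlgebra).GNSSpace →L[ℂ] (φ.restrict rightAlgebra).GNSSpace),
      (∀ θ, ImplementsRight rightAlgebra.subtype (φ.restrict rightAlgebra).gnsRep θ (W θ)) ∧
      ∀ k, Filter.Tendsto (fun θ => (W θ : (φ.restrict rightAlgebra).GNSSpace →L[ℂ]
        (φ.restrict rightAlgebra).GNSSpace) k) (nhds 0) (nhds k) := by
  have h1 : Isometry (rightAlgebra.subtype) := isometry_subtype_coe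
  exact exists_implementsRight (φ.restrict rightAlgebra) h1 (fun b => b.2)
    (fun r hr => ⟨⟨r, hr⟩, rfl⟩) (restrict_eq_of_gauge hgauge)

theorem exists_isRightSubrep (φ : State quasiLocal) :
    ∃ J : (φ.restrict rightAlgebra).GNSSpace →ₗᵢ[ℂ] φ.GNSSpace,
      IsRightSubrep φ.gnsRep rightAlgebra.subtype (φ.restrict rightAlgebra).gnsRep J :=
  (φ.exists_isometry_restrict rightAlgebra).imp fun _ hJ => isRightSubrep_restrict hJ

/-- Small gauge rotations of the right half-chain are implemented in the GNS representation by
unitaries that tend strongly to the identity. -/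
theorem State.IsPure.exists_implements_tendsto (hpure : φ.IsPure)
    (hgauge : ∀ (θ : ℝ) (a : quasiLocal), φ (gauge θ a) = φ a)
    (htypeI : (φ.restrict rightAlgebra).IsTypeIRep) :
    ∃ U : ℝ → unitary (φ.GNSSpace →L[ℂ] φ.GNSSpace),
      (∀ᶠ θ in nhds 0, Implements φ.gnsRep θ (U θ)) ∧
      ∀ x, Filter.Tendsto (fun θ => (U θ : φ.GNSSpace →L[ℂ] φ.GNSSpace) x) (nhds 0) (nhds x) :=
  (exists_isRightSubrep φ).elim fun _ hJ => htypeI.exists_isAbelianProjection.elim fun _ he =>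
    (exists_implementsRight_restrict hgauge).elim fun _ hW =>
      SpinChain.exists_implements_tendsto hpure.isIrreducibleRep hJ he hW.1 hW.2

end Concrete

/-! ### Translation of implementers and the resulting character -/

section Character

/-- The matrix `diag (1, z)`. -/
def phaseMatrix (z : ℂ) : Matrix (Fin 2) (Fin 2) ℂ := Matrix.diagonal ![1, z]

theorem phaseMatrix_mul (z w : ℂ) : phaseMatrix z * phaseMatrix w = phaseMatrix (z * w) := by
  rw [phaseMatrix, phaseMatrix, phaseMatrix, Matrix.diagonal_mul_diagonal]
  congr 1
  ext i
  fin_cases i <;> simp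

theorem phaseMatrix_one : phaseMatrix 1 = 1 := by
  rw [phaseMatrix, ← Matrix.diagonal_one]
  congr 1
  ext i
  fin_cases i <;> simp

theorem star_phaseMatrix (z : ℂ) : star (phaseMatrix z) = phaseMatrix (star z) := by
  rw [phaseMatrix, phaseMatrix, Matrix.star_eq_conjTranspose, Matrix.diagonal_conjTranspose]
  congr 1
  ext i
  fin_cases i <;> simp

/-- `diag (1, exp (-iθ))` is a scalar multiple of `rotZ θ`, so it implements the same one-site
rotation. Unlike `rotZ`, it is `2π`-periodic in `θ`, which is what makes the character take the
value `1` at `2π`. -/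
theorem phaseMatrix_mul_eq (θ : ℝ) (Q : Matrix (Fin 2) (Fin 2) ℂ) :
    phaseMatrix (Complex.exp (-(Complex.I * θ))) * Q =
      rotZ θ * Q * rotZ (-θ) * phaseMatrix (Complex.exp (-(Complex.I * θ))) := by
  have h : phaseMatrix (Complex.exp (-(Complex.I * θ))) =
      Complex.exp (-(Complex.I * θ / 2)) • rotZ θ := by
    rw [phaseMatrix, rotZ, ← Matrix.diagonal_smul]
    congr 1
    ext i
    fin_cases i
    · simp [← Complex.exp_add]
    · simp only [← Complex.exp_add, Fin.mk_one, Matrix.cons_val_one, Matrix.cons_val_fin_one,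
        Pi.smul_apply, smul_eq_mul]
      ring_nf
  rw [h, smul_mul_assoc, mul_smul_comm, mul_assoc _ _ (rotZ θ), rotZ_mul, neg_add_cancel, rotZ_zero,
    mul_one]

theorem rotZ_two_pi : rotZ (2 * Real.pi) = -1 := by
  rw [rotZ, ← Matrix.diagonal_one, Matrix.diagonal_neg]
  congr 1
  have h : Complex.I * ((2 * Real.pi : ℝ) : ℂ) / 2 = Real.pi * Complex.I := by
    push_cast; ring
  ext i
  fin_cases i
  · simp only [h]; simp
  · simp only [h]; simp [Complex.exp_neg]

theorem gauge_two_pi_site (j : ℤ) (Q : Matrix (Fin 2) (Fin 2) ℂ) :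
    gauge (2 * Real.pi) (site j Q) = site j Q := by
  have h : rotZ (-(2 * Real.pi)) = -1 := by
    have := rotZ_mul (2 * Real.pi) (-(2 * Real.pi))
    rw [add_neg_cancel, rotZ_zero, rotZ_two_pi, neg_one_mul] at this
    rw [← this, neg_neg]
  rw [gauge_site, rotZ_two_pi, h]
  simp

variable {H : Type*} [NormedAddCommGroup H] [InnerProductSpace ℂ H] [CompleteSpace H]
  {π : quasiLocal →⋆ₐ[ℂ] (H →L[ℂ] H)}

theorem Implements.mul {θ θ' : ℝ} {U U' : H →L[ℂ] H} (h : Implements π θ U)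
    (h' : Implements π θ' U') : Implements π (θ + θ') (U * U') := by
  refine ⟨fun j hj Q => (h.1 j hj Q).mul_left (h'.1 j hj Q), fun j hj Q => ?_⟩
  rw [mul_assoc, h'.2 j hj, gauge_site, ← mul_assoc, h.2 j hj, ← gauge_site, gauge_gauge, mul_assoc]

theorem Implements.pow {θ : ℝ} {U : H →L[ℂ] H} (h : Implements π θ U) (n : ℕ) :
    Implements π (n * θ) (U ^ n) := by
  induction n with
  | zero =>
    refine ⟨fun j _ Q => by simp, fun j _ Q => ?_⟩
    simp [gauge_zero]
  | succ n ih =>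
    have := ih.mul h
    rwa [← pow_succ, show (n : ℝ) * θ + θ = ((n + 1 : ℕ) : ℝ) * θ by push_cast; ring] at this

/-- Divide the angle by a large `n` and take the `n`-th power of the implementer of the small
rotation. -/
theorem exists_implements_of_eventually {U : ℝ → unitary (H →L[ℂ] H)}
    (h : ∀ᶠ θ in nhds 0, Implements π θ (U θ)) (θ : ℝ) :
    ∃ V : unitary (H →L[ℂ] H), Implements π θ V := by
  have hlim : Filter.Tendsto (fun n : ℕ => θ / n) Filter.atTop (nhds 0) :=
    tendsto_const_div_atTop_nhds_zero_nat θ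
  obtain ⟨n, hn, hn0⟩ := ((hlim.eventually h).and (Filter.eventually_gt_atTop 0)).exists
  refine ⟨U (θ / n) ^ n, ?_⟩
  have := hn.pow n
  rwa [mul_div_cancel₀ θ (by exact_mod_cast hn0.ne' : (n : ℝ) ≠ 0)] at this

/-- Two implementers of the same rotation agree up to a scalar. -/
theorem IsIrreducibleRep.implements_unique (hπ : IsIrreducibleRep π) {θ : ℝ}
    {V : unitary (H →L[ℂ] H)} {U : H →L[ℂ] H} (hV : Implements π θ V) (hU : Implements π θ U) :
    ∃ c : ℂ, U = c • (V : H →L[ℂ] H) := by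
  obtain ⟨c, hc⟩ := hπ (star (V : H →L[ℂ] H) * U) fun j Q => by
    have key : ∀ x y : H →L[ℂ] H, U * x = y * U → (V : H →L[ℂ] H) * x = y * V →
        Commute (star (V : H →L[ℂ] H) * U) x := by
      intro x y h1 h2
      change star (V : H →L[ℂ] H) * U * x = x * (star (V : H →L[ℂ] H) * U)
      rw [mul_assoc, h1, ← mul_assoc, ← mul_star_comm_of_unitary h2, mul_assoc]
    rcases le_or_gt j 0 with hj | hj
    · exact key _ _ (hU.1 j hj Q) (hV.1 j hj Q)
    · exact key _ _ (hU.2 j hj Q) (hV.2 j hj Q)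
  refine ⟨c, ?_⟩
  have h2 : (V : H →L[ℂ] H) * star (V : H →L[ℂ] H) = 1 := Unitary.mul_star_self_of_mem V.2
  calc U = (V : H →L[ℂ] H) * (star (V : H →L[ℂ] H) * U) := by rw [← mul_assoc, h2, one_mul]
    _ = _ := by rw [hc, mul_smul_comm, mul_one]

variable {T : unitary (H →L[ℂ] H)}

variable (π T) in
/-- The translate of an operator by one site, completed to the right half-chain by the rotation of
the first spin. -/
noncomputable def shiftImplementer (θ : ℝ) (U : H →L[ℂ] H) : H →L[ℂ] H :=
  π (site 1 (phaseMatrix (Complex.exp (-(Complex.I * θ))))) *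
    ((T : H →L[ℂ] H) * U * star (T : H →L[ℂ] H))

theorem conj_mul_site
    (hT : ∀ a, (T : H →L[ℂ] H) * π a = π (translation 1 a) * T) {U : H →L[ℂ] H} {j : ℤ}
    {Q R : Matrix (Fin 2) (Fin 2) ℂ} (h : U * π (site (j - 1) Q) = π (site (j - 1) R) * U) :
    (T : H →L[ℂ] H) * U * star (T : H →L[ℂ] H) * π (site j Q) =
      π (site j R) * ((T : H →L[ℂ] H) * U * star (T : H →L[ℂ] H)) := by
  have hT' : ∀ R, (T : H →L[ℂ] H) * π (site (j - 1) R) = π (site j R) * T := fun R => by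
    rw [hT, translation_site, add_sub_cancel]
  have hT2 := mul_star_comm_of_unitary (hT' Q)
  rw [mul_assoc, ← hT2, ← mul_assoc, mul_assoc _ U, h, ← mul_assoc, hT' R]
  simp only [mul_assoc]

/-- Conjugating by `T` moves the cut one site to the right: `T U T*` rotates the sites from `2` on
and commutes with those up to `1`. The missing rotation of site `1` is the extra factor. -/
theorem Implements.shiftImplementer {θ : ℝ} {U : H →L[ℂ] H} (h : Implements π θ U)
    (hT : ∀ a, (T : H →L[ℂ] H) * π a = π (translation 1 a) * T) :
    Implements π θ (shiftImplementer π T θ U) := by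
  refine ⟨fun j hj Q => ?_, fun j hj Q => ?_⟩
  · refine Commute.mul_left ?_ (conj_mul_site hT (h.1 (j - 1) (by omega) Q))
    exact (site_commute (by omega) _ _).map π
  · rw [gauge_site]
    unfold SpinChain.shiftImplementer
    rcases eq_or_lt_of_le hj with rfl | hj'
    · rw [mul_assoc, conj_mul_site hT (h.1 (1 - 1) (by omega) Q), ← mul_assoc, ← map_mul, ← map_mul,
        phaseMatrix_mul_eq, map_mul, map_mul, mul_assoc]
    · have h1 := h.2 (j - 1) (by omega) Q
      rw [gauge_site] at h1
      have h2 := conj_mul_site hT h1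
      have h3 := ((site_commute (show (1 : ℤ) ≠ j by omega)
        (phaseMatrix (Complex.exp (-(Complex.I * θ)))) (rotZ θ * Q * rotZ (-θ))).map π).eq
      rw [mul_assoc, h2, ← mul_assoc, h3, mul_assoc]

theorem site_phaseMatrix_mem_unitary (j : ℤ) {z : ℂ} (hz : ‖z‖ = 1) :
    site j (phaseMatrix z) ∈ unitary quasiLocal := by
  have h1 : star z * z = 1 := by
    rw [Complex.star_def, Complex.conj_mul', hz]; simp
  rw [Unitary.mem_iff, ← map_star, ← map_mul, ← map_mul, star_phaseMatrix, phaseMatrix_mul,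
    phaseMatrix_mul, mul_comm z, h1, phaseMatrix_one, _root_.map_one]
  exact ⟨rfl, rfl⟩

theorem norm_exp_neg_I_mul (θ : ℝ) : ‖Complex.exp (-(Complex.I * θ))‖ = 1 := by
  rw [show -(Complex.I * (θ : ℂ)) = ((-θ : ℝ) : ℂ) * Complex.I by push_cast; ring]
  exact Complex.norm_exp_ofReal_mul_I _

theorem shiftImplementer_mem_unitary (θ : ℝ) (U : unitary (H →L[ℂ] H)) :
    shiftImplementer π T θ U ∈ unitary (H →L[ℂ] H) := by
  refine mul_mem ?_ (mul_mem (mul_mem T.2 U.2) (star T).2)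
  exact Unitary.map_mem π (site_phaseMatrix_mem_unitary 1 (norm_exp_neg_I_mul θ))

/-- Multiplicativity holds because `T U T*` commutes with the factor at site `1`, as `U` commutes
with site `0`. -/
theorem shiftImplementer_mul {θ θ' : ℝ} {U U' : H →L[ℂ] H} (h : Implements π θ U)
    (hT : ∀ a, (T : H →L[ℂ] H) * π a = π (translation 1 a) * T) :
    shiftImplementer π T (θ + θ') (U * U') =
      shiftImplementer π T θ U * shiftImplementer π T θ' U' := by
  have h1 : star (T : H →L[ℂ] H) * T = 1 := Unitary.star_mul_self_of_mem T.2
  have h2 := conj_mul_site hT (h.1 (1 - 1) (by omega)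
    (phaseMatrix (Complex.exp (-(Complex.I * θ')))))
  have h3 : phaseMatrix (Complex.exp (-(Complex.I * ((θ + θ' : ℝ) : ℂ)))) =
      phaseMatrix (Complex.exp (-(Complex.I * θ))) *
        phaseMatrix (Complex.exp (-(Complex.I * θ'))) := by
    rw [phaseMatrix_mul, ← Complex.exp_add]
    push_cast
    ring_nf
  unfold shiftImplementer
  rw [h3, map_mul, map_mul]
  generalize π (site 1 (phaseMatrix (Complex.exp (-(Complex.I * θ))))) = a at *
  generalize π (site 1 (phaseMatrix (Complex.exp (-(Complex.I * θ'))))) = b at *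
  calc a * b * ((T : H →L[ℂ] H) * (U * U') * star (T : H →L[ℂ] H))
      = a * b * ((T : H →L[ℂ] H) * U * 1 * U' * star (T : H →L[ℂ] H)) := by
        rw [mul_one]; simp only [mul_assoc]
    _ = a * (b * ((T : H →L[ℂ] H) * U * star (T : H →L[ℂ] H))) *
          (T * U' * star (T : H →L[ℂ] H)) := by
        rw [← h1]; simp only [mul_assoc]
    _ = _ := by rw [← h2]; simp only [mul_assoc]

theorem unitary_ne_zero [Nontrivial H] (V : unitary (H →L[ℂ] H)) : (V : H →L[ℂ] H) ≠ 0 := by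
  intro h
  obtain ⟨x, hx⟩ := exists_ne (0 : H)
  have := norm_unitary_apply V x
  rw [h, zero_apply, norm_zero] at this
  exact hx (norm_eq_zero.mp this.symm)

/-- The implementers of the gauge rotations transform under translations with a character. -/
theorem IsIrreducibleRep.exists_character [Nontrivial H] (hπ : IsIrreducibleRep π)
    (hT : ∀ a, (T : H →L[ℂ] H) * π a = π (translation 1 a) * T)
    (hex : ∀ θ, ∃ U : unitary (H →L[ℂ] H), Implements π θ U) :
    ∃ χ : ℝ → ℂ, (∀ θ, ‖χ θ‖ = 1) ∧ (∀ θ θ', χ (θ + θ') = χ θ * χ θ') ∧ χ (2 * Real.pi) = 1 ∧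
      ∀ θ, ∀ U : unitary (H →L[ℂ] H), Implements π θ U →
        (U : H →L[ℂ] H) = χ θ • shiftImplementer π T θ U := by
  have hc : ∀ θ, ∃ c : ℂ, ∀ U : unitary (H →L[ℂ] H), Implements π θ U →
      (U : H →L[ℂ] H) = c • shiftImplementer π T θ U := by
    intro θ
    obtain ⟨V, hV⟩ := hex θ
    obtain ⟨c, hc⟩ := hπ.implements_unique (V := ⟨_, shiftImplementer_mem_unitary θ V⟩)
      (hV.shiftImplementer hT) hV
    refine ⟨c, fun U hU => ?_⟩
    -- Any other implementer is `d V`, and both sides of the relation scale by `d`; so the phase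
    -- depends on `θ` only.
    obtain ⟨d, hd⟩ := hπ.implements_unique hV hU
    have h1 : shiftImplementer π T θ U = d • shiftImplementer π T θ V := by
      unfold shiftImplementer
      rw [hd, mul_smul_comm, smul_mul_assoc, mul_smul_comm]
    rw [h1, smul_comm, ← hc, hd]
  choose χ hχ using hc
  obtain ⟨x, hx⟩ := exists_ne (0 : H)
  refine ⟨χ, fun θ => ?_, fun θ θ' => ?_, ?_, hχ⟩
  · obtain ⟨V, hV⟩ := hex θ
    have h1 := congrArg norm (DFunLike.congr_fun (hχ θ V hV) x)
    rw [smul_apply, norm_smul, norm_unitary_apply,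
      norm_unitary_apply ⟨_, shiftImplementer_mem_unitary θ V⟩] at h1
    exact mul_right_cancel₀ (norm_ne_zero_iff.mpr hx) (by rw [← h1, one_mul])
  · obtain ⟨V, hV⟩ := hex θ
    obtain ⟨V', hV'⟩ := hex θ'
    have h1 := hχ (θ + θ') (V * V') (hV.mul hV')
    have h2 : (V : H →L[ℂ] H) * V' =
        (χ θ * χ θ') • shiftImplementer π T (θ + θ') ((V * V' : unitary (H →L[ℂ] H))) := by
      rw [Submonoid.coe_mul, shiftImplementer_mul hV hT]
      conv_lhs => rw [hχ θ V hV, hχ θ' V' hV']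
      rw [smul_mul_assoc, mul_smul_comm, smul_smul]
    have h1 : (V : H →L[ℂ] H) * V' = _ := h1
    replace h1 := h2.symm.trans h1
    exact (smul_left_injective ℂ (unitary_ne_zero
      ⟨_, shiftImplementer_mem_unitary (π := π) (T := T) (θ + θ') (V * V')⟩) h1).symm
  -- The rotation by `2π` is trivial on observables, so `1` implements it, and its shifted version
  -- is again `1`.
  · have h1 := hχ (2 * Real.pi) 1 ⟨fun j _ Q => by simp, fun j _ Q => by
      rw [gauge_two_pi_site]; simp⟩
    have h2 : Complex.exp (-(Complex.I * ((2 * Real.pi : ℝ) : ℂ))) = 1 := by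
      rw [Complex.exp_neg, mul_comm]
      push_cast
      rw [Complex.exp_two_pi_mul_I, inv_one]
    have h3 : (T : H →L[ℂ] H) * star (T : H →L[ℂ] H) = 1 := Unitary.mul_star_self_of_mem T.2
    unfold shiftImplementer at h1
    rw [h2, phaseMatrix_one, _root_.map_one, _root_.map_one, OneMemClass.coe_one, mul_one, h3,
      one_mul] at h1
    have h4 := DFunLike.congr_fun h1 x
    rw [one_apply_eq_self, smul_apply, one_apply_eq_self] at h4
    exact smul_left_injective ℂ hx (by simpa using h4.symm)

end Character

/-! ### Distribution of the number of down spins in a block -/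

section Counting

/-- `∏_{j=1}^n diag (1, z)^{(j)}`. -/
noncomputable def phaseProd (z : ℂ) : ℕ → quasiLocal
  | 0 => 1
  | n + 1 => site 1 (phaseMatrix z) * translation 1 (phaseProd z n)

theorem phaseProd_star_mul_self {z : ℂ} (hz : ‖z‖ = 1) (n : ℕ) :
    star (phaseProd z n) * phaseProd z n = 1 := by
  induction n with
  | zero => simp [phaseProd]
  | succ n ih =>
    have h1 : star (site 1 (phaseMatrix z)) * site 1 (phaseMatrix z) = 1 :=
      (Unitary.mem_iff.mp (site_phaseMatrix_mem_unitary 1 hz)).1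
    have h2 := congrArg (translation 1) ih
    rw [map_mul (translation 1), map_star (translation 1), _root_.map_one] at h2
    rw [phaseProd, star_mul, mul_assoc, ← mul_assoc _ (site 1 (phaseMatrix z)), h1, one_mul, h2]

variable {φ : State quasiLocal}

theorem single_add_smul_single (z : ℂ) :
    (Matrix.single 0 0 1 + z • Matrix.single 1 1 1 : Matrix (Fin 2) (Fin 2) ℂ) = phaseMatrix z := by
  ext i j
  fin_cases i <;> fin_cases j <;> simp [phaseMatrix]

theorem star_site_single_mul_self (j : ℤ) (i : Fin 2) :
    star (site j (Matrix.single i i 1)) * site j (Matrix.single i i 1) =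
      site j (Matrix.single i i 1) := by
  rw [← map_star, ← map_mul]
  congr 1
  rw [Matrix.star_eq_conjTranspose, Matrix.conjTranspose_single, Matrix.single_mul_single_same]
  simp

theorem translation_commute_site {P : quasiLocal} {j : ℤ} {Q : Matrix (Fin 2) (Fin 2) ℂ}
    (h : Commute P (site (j - 1) Q)) : Commute (translation 1 P) (site j Q) := by
  have := h.map (translation 1)
  rwa [translation_site, add_sub_cancel] at this

theorem star_mul_self_mul_of_commute {A : Type*} [Semiring A] [StarRing A] {p q : A}
    (hp : star p * p = p) (hq : star q * q = q) (h : Commute p q) :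
    star (p * q) * (p * q) = p * q := by
  have hp' : star p = p := by rw [← hp, star_mul, star_star]
  have hq' : star q = q := by rw [← hq, star_mul, star_star]
  rw [hp'] at hp
  rw [hq'] at hq
  rw [star_mul, hp', hq', mul_assoc, ← mul_assoc p p, hp, h.eq, ← mul_assoc, hq]

set_option maxHeartbeats 1000000 in
/-- The spectral projections of the number of down spins on the sites `1, …, n`. -/
theorem exists_counting_projections
    (htrans : ∀ (k : ℤ) (a : quasiLocal), φ (translation k a) = φ a) (n : ℕ) :
    ∃ (ι : Type) (_ : Fintype ι) (P : ι → quasiLocal) (N : ι → ℕ),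
      (∀ a, star (P a) * P a = P a) ∧ (∀ a, ∀ j ≤ 0, ∀ Q, Commute (P a) (site j Q)) ∧
      ∑ a, P a = 1 ∧ (∀ a, N a ≤ n) ∧ (∀ z : ℂ, phaseProd z n = ∑ a, z ^ N a • P a) ∧
      ∑ a, (N a : ℂ) * φ (P a) = n * φ (site 1 (Matrix.single 1 1 1)) := by
  induction n with
  | zero =>
    refine ⟨Unit, inferInstance, fun _ => 1, fun _ => 0, ?_, ?_, ?_, ?_, ?_, ?_⟩
    · simp
    · intro _ j _ Q; exact Commute.one_left _
    · simp
    · simp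
    · simp [phaseProd]
    · simp
  | succ n ih =>
    obtain ⟨ι, hι, P, N, hP, hc, h1, hN, hz, hs⟩ := ih
    have hfe : site 1 (Matrix.single 0 0 1) + site 1 (Matrix.single 1 1 1) = 1 := by
      rw [← map_add, ← _root_.map_one (site 1), ← phaseMatrix_one, ← single_add_smul_single,
        one_smul]
    have hfz : ∀ z : ℂ, site 1 (phaseMatrix z) =
        site 1 (Matrix.single 0 0 1) + z • site 1 (Matrix.single 1 1 1) := fun z => by
      rw [← single_add_smul_single, map_add, map_smul]
    have hcomm : ∀ a, ∀ j ≤ 1, ∀ Q, Commute (translation 1 (P a)) (site j Q) := fun a j hj Q =>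
      translation_commute_site (hc a (j - 1) (by omega) Q)
    have hsum : ∑ a, translation 1 (P a) = 1 := by rw [← map_sum, h1, _root_.map_one]
    have hτ : ∀ a, star (translation 1 (P a)) * translation 1 (P a) = translation 1 (P a) :=
      fun a => by rw [← map_star (translation 1), ← map_mul (translation 1), hP]
    -- Each old projection is shifted by one site and split according to the spin at site `1`: up
    -- keeps the count, down adds one. The index thus records the whole spin pattern, and a given
    -- count may occur several times.
    refine ⟨ι ⊕ ι, inferInstance,
      Sum.elim (fun a => site 1 (Matrix.single 0 0 1) * translation 1 (P a))
        (fun a => site 1 (Matrix.single 1 1 1) * translation 1 (P a)),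
      Sum.elim N (fun a => N a + 1), ?_, ?_, ?_, ?_, ?_, ?_⟩
    · rintro (a | a)
      · exact star_mul_self_mul_of_commute (star_site_single_mul_self 1 0) (hτ a)
          (hcomm a 1 le_rfl _).symm
      · exact star_mul_self_mul_of_commute (star_site_single_mul_self 1 1) (hτ a)
          (hcomm a 1 le_rfl _).symm
    · rintro (a | a) j hj Q
      · exact (site_commute (by omega) _ _).mul_left (hcomm a j (by omega) Q)
      · exact (site_commute (by omega) _ _).mul_left (hcomm a j (by omega) Q)
    · rw [Fintype.sum_sum_type]
      simp only [Sum.elim_inl, Sum.elim_inr]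
      rw [← Finset.mul_sum, ← Finset.mul_sum, hsum, mul_one, mul_one, hfe]
    · rintro (a | a)
      · exact (hN a).trans (Nat.le_succ n)
      · exact Nat.succ_le_succ (hN a)
    · intro z
      rw [Fintype.sum_sum_type, phaseProd, hz z, hfz z, map_sum, Finset.mul_sum,
        ← Finset.sum_add_distrib]
      refine Finset.sum_congr rfl fun a _ => ?_
      simp only [Sum.elim_inl, Sum.elim_inr]
      rw [map_smul, mul_smul_comm, add_mul, smul_add, smul_mul_assoc, smul_smul, pow_succ]
    · rw [Fintype.sum_sum_type]
      simp only [Sum.elim_inl, Sum.elim_inr]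
      have h3 : ∀ a, φ (site 1 (Matrix.single 0 0 1) * translation 1 (P a)) +
          φ (site 1 (Matrix.single 1 1 1) * translation 1 (P a)) = φ (P a) := fun a => by
        rw [← map_add, ← add_mul, hfe, one_mul, htrans]
      have h4 : ∑ a, φ (site 1 (Matrix.single 1 1 1) * translation 1 (P a)) =
          φ (site 1 (Matrix.single 1 1 1)) := by
        rw [← map_sum, ← Finset.mul_sum, hsum, mul_one]
      -- The old counts recombine over the two values of the new spin and reproduce the old mean by
      -- translation invariance; the added ones sum to the density at site `1`.
      have h5 : ∀ a, ((N a + 1 : ℕ) : ℂ) * φ (site 1 (Matrix.single 1 1 1) * translation 1 (P a)) =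
          N a * φ (site 1 (Matrix.single 1 1 1) * translation 1 (P a)) +
            φ (site 1 (Matrix.single 1 1 1) * translation 1 (P a)) := fun a => by
        push_cast; ring
      simp only [h5, Finset.sum_add_distrib, h4]
      rw [← add_assoc, ← Finset.sum_add_distrib]
      simp only [← mul_add, h3, hs]
      push_cast
      ring

/-- The distribution of the number of down spins on the sites `1, …, n`. -/
theorem exists_distribution (htrans : ∀ (k : ℤ) (a : quasiLocal), φ (translation k a) = φ a)
    (n : ℕ) :
    ∃ (ι : Type) (_ : Fintype ι) (w : ι → ℝ) (N : ι → ℕ), (∀ a, 0 ≤ w a) ∧ ∑ a, w a = 1 ∧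
      (∀ a, N a ≤ n) ∧ (∀ z : ℂ, φ (phaseProd z n) = ∑ a, (w a : ℂ) * z ^ N a) ∧
      ((∑ a, w a * N a : ℝ) : ℂ) = n * φ (site 1 (Matrix.single 1 1 1)) := by
  obtain ⟨ι, hι, P, N, hP, -, h1, hN, hz, hs⟩ := exists_counting_projections htrans n
  have hpos : ∀ a, 0 ≤ φ (P a) := fun a => by
    have := φ.nonneg (P a)
    rwa [hP a] at this
  have hre : ∀ a, ((φ (P a)).re : ℂ) = φ (P a) := fun a =>
    (Complex.eq_re_of_ofReal_le (hpos a)).symm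
  refine ⟨ι, hι, fun a => (φ (P a)).re, N, fun a => (Complex.nonneg_iff.mp (hpos a)).1, ?_, hN,
    fun z => ?_, ?_⟩
  · have h2 : ((∑ a, (φ (P a)).re : ℝ) : ℂ) = 1 := by
      push_cast
      simp only [hre]
      rw [← map_sum, h1]
      exact φ.map_one
    exact_mod_cast h2
  · rw [hz, map_sum]
    refine Finset.sum_congr rfl fun a _ => ?_
    rw [map_smul, hre, smul_eq_mul, mul_comm]
  · push_cast
    simp only [hre]
    rw [← hs]
    exact Finset.sum_congr rfl fun a _ => mul_comm _ _

end Counting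

/-! ### Means from characteristic functions, and characters of the circle -/

section Drift

open MeasureTheory

theorem integral_one_sub_cos (δ x : ℝ) (hx : x ≠ 0) :
    ∫ θ in (0 : ℝ)..δ, (1 - Real.cos (θ * x)) = δ - Real.sin (δ * x) / x := by
  rw [intervalIntegral.integral_sub (by simp) (by apply Continuous.intervalIntegrable; fun_prop)]
  simp [intervalIntegral.integral_comp_mul_right _ hx]
  field_simp

/-- The bound is trivial when `|x| ≤ 2 / δ`. Otherwise `|sin (δx) / x| ≤ δ / 2`, so the integral is
at least `δ / 2` and the second term alone is at least `M`. -/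
theorem abs_le_integral {δ x M : ℝ} (hδ : 0 < δ) (hM : |x| ≤ M) :
    |x| ≤ 2 / δ + M * (2 / δ) * ∫ θ in (0 : ℝ)..δ, (1 - Real.cos (θ * x)) := by
  have hM0 : 0 ≤ M := (abs_nonneg x).trans hM
  have hI : 0 ≤ ∫ θ in (0 : ℝ)..δ, (1 - Real.cos (θ * x)) :=
    intervalIntegral.integral_nonneg hδ.le fun θ _ => sub_nonneg.mpr (Real.cos_le_one _)
  rcases le_or_gt |x| (2 / δ) with h | h
  · have : 0 ≤ M * (2 / δ) * ∫ θ in (0 : ℝ)..δ, (1 - Real.cos (θ * x)) := by positivity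
    linarith
  · have hx : x ≠ 0 := by
      rintro rfl
      simp only [abs_zero] at h
      exact absurd h (not_lt.mpr (by positivity))
    have h1 : δ / 2 ≤ ∫ θ in (0 : ℝ)..δ, (1 - Real.cos (θ * x)) := by
      rw [integral_one_sub_cos δ x hx]
      have h2 : |Real.sin (δ * x) / x| ≤ δ / 2 := by
        rw [abs_div, div_le_iff₀ (abs_pos.mpr hx)]
        have h3 := Real.abs_sin_le_one (δ * x)
        rw [div_lt_iff₀ hδ] at h
        linarith
      linarith [(abs_le.mp h2).2]
    have h2 : M * (2 / δ) * (δ / 2) = M := by field_simp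
    have h3 : M * (2 / δ) * (δ / 2) ≤ M * (2 / δ) * ∫ θ in (0 : ℝ)..δ, (1 - Real.cos (θ * x)) := by
      gcongr
    have : 0 < 2 / δ := by positivity
    linarith

/-- A truncation inequality: a characteristic function near `1` on `[0, δ]` leaves little mass
outside `|x| ≤ 2 / δ`, and that mass contributes at most `M` per unit. It follows by averaging the
pointwise bound `abs_le_integral`. -/
theorem abs_sum_le_of_sum_cos_le {ι : Type*} [Fintype ι] {w x : ι → ℝ} (hw : ∀ a, 0 ≤ w a)
    (hw1 : ∑ a, w a = 1) {δ η M : ℝ} (hδ : 0 < δ) (hx : ∀ a, |x a| ≤ M)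
    (hM : 0 ≤ M)
    (h : ∀ θ ∈ Set.Icc 0 δ, ∑ a, w a * (1 - Real.cos (θ * x a)) ≤ η) :
    |∑ a, w a * x a| ≤ 2 / δ + 2 * M * η := by
  have hInt : ∀ a, IntervalIntegrable (fun θ => w a * (1 - Real.cos (θ * x a))) volume 0 δ :=
    fun a => Continuous.intervalIntegrable (by fun_prop) _ _
  have h1 : ∑ a, w a * ∫ θ in (0 : ℝ)..δ, (1 - Real.cos (θ * x a)) ≤ δ * η := by
    have h2 : ∫ θ in (0 : ℝ)..δ, ∑ a, w a * (1 - Real.cos (θ * x a)) ≤ ∫ _ in (0 : ℝ)..δ, η :=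
      intervalIntegral.integral_mono_on hδ.le
        (Continuous.intervalIntegrable (by fun_prop) _ _) (by simp) h
    rw [intervalIntegral.integral_finsetSum fun a _ => hInt a] at h2
    simpa [intervalIntegral.integral_const_mul] using h2
  calc |∑ a, w a * x a| ≤ ∑ a, w a * |x a| := by
        refine (Finset.abs_sum_le_sum_abs _ _).trans_eq (Finset.sum_congr rfl fun a _ => ?_)
        rw [abs_mul, abs_of_nonneg (hw a)]
    _ ≤ ∑ a, w a * (2 / δ + M * (2 / δ) * ∫ θ in (0 : ℝ)..δ, (1 - Real.cos (θ * x a))) :=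
        Finset.sum_le_sum fun a _ => mul_le_mul_of_nonneg_left (abs_le_integral hδ (hx a)) (hw a)
    _ = 2 / δ + M * (2 / δ) * ∑ a, w a * ∫ θ in (0 : ℝ)..δ, (1 - Real.cos (θ * x a)) := by
        simp only [mul_add, Finset.sum_add_distrib, ← Finset.sum_mul, hw1, one_mul, Finset.mul_sum]
        congr 1
        exact Finset.sum_congr rfl fun a _ => by ring
    _ ≤ 2 / δ + M * (2 / δ) * (δ * η) := by gcongr
    _ = 2 / δ + 2 * M * η := by field_simp

/-- A continuous character of the circle group is a power. -/
theorem exists_int_of_character {χ : ℝ → ℂ} (hmul : ∀ θ θ', χ (θ + θ') = χ θ * χ θ')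
    (hn : ∀ θ, ‖χ θ‖ = 1) (h2 : χ (2 * Real.pi) = 1) (hc : Filter.Tendsto χ (nhds 0) (nhds 1)) :
    ∃ m : ℤ, ∀ θ, χ θ = Complex.exp (Complex.I * m * θ) := by
  have hcont : Continuous χ := by
    rw [continuous_iff_continuousAt]
    intro θ
    have h1 : Filter.Tendsto (fun t => χ θ * χ (t - θ)) (nhds θ) (nhds (χ θ * 1)) :=
      (hc.comp (by simpa using (continuous_sub_right θ).tendsto θ)).const_mul _
    rw [mul_one] at h1
    refine h1.congr fun t => ?_
    rw [← hmul, add_sub_cancel]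
  have hper : Function.Periodic χ (2 * Real.pi) := fun θ => by rw [hmul, h2, mul_one]
  have : Fact (0 < 2 * Real.pi) := ⟨Real.two_pi_pos⟩
  let f : C(AddCircle (2 * Real.pi), ℂ) :=
    ⟨hper.lift, continuous_coinduced_dom.mpr hcont⟩
  have hf : ∀ θ : ℝ, f θ = χ θ := fun θ => hper.lift_coe θ
  -- If all coefficients vanished, the trivially summable Fourier series would give `f = 0` at the
  -- point `0`, against `‖χ 0‖ = 1`.
  obtain ⟨m, hm⟩ : ∃ m, fourierCoeff f m ≠ 0 := by
    by_contra! hcon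
    have h0 : fourierCoeff f = 0 := funext hcon
    have hs := has_pointwise_sum_fourier_series_of_summable (f := f)
      (by rw [h0]; exact summable_zero) ((0 : ℝ) : AddCircle (2 * Real.pi))
    simp only [hcon, zero_smul] at hs
    have h1 := hs.unique hasSum_zero
    rw [hf] at h1
    have h3 := hn 0
    rw [h1, norm_zero] at h3
    exact zero_ne_one h3
  refine ⟨m, fun θ => ?_⟩
  -- Translating the integration variable by `θ` multiplies the coefficient by `exp (-imθ) χ(θ)`; as
  -- the coefficient is nonzero, this factor is `1`.
  have key : fourierCoeff f m =
      fourier (-m) (θ : AddCircle (2 * Real.pi)) * χ θ * fourierCoeff f m := by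
    conv_lhs => rw [fourierCoeff, ← integral_add_right_eq_self _ (θ : AddCircle (2 * Real.pi))]
    rw [fourierCoeff, ← integral_const_mul]
    refine integral_congr_ae (Filter.Eventually.of_forall fun t => ?_)
    induction t using QuotientAddGroup.induction_on with
    | H t =>
      have h4 : f ((t : AddCircle (2 * Real.pi)) + (θ : AddCircle (2 * Real.pi))) = χ t * χ θ := by
        rw [← hmul, ← hf]; rfl
      have h5 : f (t : AddCircle (2 * Real.pi)) = χ t := hf t
      have h6 : fourier (-m) ((t : AddCircle (2 * Real.pi)) + (θ : AddCircle (2 * Real.pi))) =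
          fourier (-m) (t : AddCircle (2 * Real.pi)) *
            (fourier (-m) (θ : AddCircle (2 * Real.pi)) : ℂ) := by
        simp [fourier_apply, smul_add, AddCircle.toCircle_add]
      simp only [smul_eq_mul]
      rw [h4, h5, h6]
      ring
  have h7 : fourier (-m) (θ : AddCircle (2 * Real.pi)) * χ θ = 1 :=
    mul_right_cancel₀ hm (by rw [← key, one_mul])
  rw [fourier_coe_apply] at h7
  rw [eq_comm, ← mul_right_inj' (Complex.exp_ne_zero _), h7, ← Complex.exp_add, ← Complex.exp_zero]
  congr 1
  have : (Real.pi : ℂ) ≠ 0 := by exact_mod_cast Real.pi_ne_zero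
  push_cast
  field_simp
  ring

end Drift

/-! ### Integrality of the density and the product property -/

section Conclusion

variable {H : Type*} [NormedAddCommGroup H] [InnerProductSpace ℂ H] [CompleteSpace H]
  {π : quasiLocal →⋆ₐ[ℂ] (H →L[ℂ] H)} {T : unitary (H →L[ℂ] H)} {Ω : H} {φ : State quasiLocal}

theorem norm_map_of_star_mul_self {v : quasiLocal} (hv : star v * v = 1) (x : H) :
    ‖π v x‖ = ‖x‖ := by
  have h : inner ℂ (π v x) (π v x) = inner ℂ x x := by
    rw [inner_map_left]
    have : π (star v) (π v x) = π (star v * v) x := by rw [map_mul]; rfl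
    rw [this, hv, _root_.map_one, one_apply_eq_self]
  rw [@norm_eq_sqrt_re_inner ℂ, @norm_eq_sqrt_re_inner ℂ _ _ _ _ x, h]

theorem norm_unitary_pow_apply (n : ℕ) (x : H) : ‖((T : H →L[ℂ] H) ^ n) x‖ = ‖x‖ := by
  rw [← SubmonoidClass.coe_pow, norm_unitary_apply]

theorem unitary_pow_apply_fixed (hTΩ : (T : H →L[ℂ] H) Ω = Ω) (n : ℕ) :
    ((T : H →L[ℂ] H) ^ n) Ω = Ω := by
  induction n with
  | zero => simp
  | succ n ih => rw [pow_succ, mul_apply_eq_comp, hTΩ, ih]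

/-- Since `T* Ω = Ω`, the relation reads `V Ω = c Z T V Ω`; substituting it into itself moves `T`
past the accumulated one-site rotations and builds up `phaseProd`. -/
theorem apply_eq_pow_smul (hT : ∀ a, (T : H →L[ℂ] H) * π a = π (translation 1 a) * T)
    (hTΩ : (T : H →L[ℂ] H) Ω = Ω) {θ : ℝ} {c : ℂ} {V : H →L[ℂ] H}
    (hV : V = c • shiftImplementer π T θ V) (n : ℕ) :
    V Ω = c ^ n • π (phaseProd (Complex.exp (-(Complex.I * θ))) n)
      (((T : H →L[ℂ] H) ^ n) (V Ω)) := by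
  induction n with
  | zero => simp [phaseProd]
  | succ n ih =>
    have hT1 : star (T : H →L[ℂ] H) Ω = Ω := by
      have := DFunLike.congr_fun (Unitary.star_mul_self_of_mem T.2) Ω
      change star (T : H →L[ℂ] H) ((T : H →L[ℂ] H) Ω) = Ω at this
      rwa [hTΩ] at this
    have h1 : V Ω = c • π (site 1 (phaseMatrix (Complex.exp (-(Complex.I * θ)))))
        ((T : H →L[ℂ] H) (V Ω)) := by
      have := DFunLike.congr_fun hV Ω
      change V Ω = c • π (site 1 (phaseMatrix (Complex.exp (-(Complex.I * θ)))))
        ((T : H →L[ℂ] H) (V (star (T : H →L[ℂ] H) Ω))) at this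
      rwa [hT1] at this
    have h2 : ∀ a x, (T : H →L[ℂ] H) (π a x) = π (translation 1 a) ((T : H →L[ℂ] H) x) :=
      fun a => DFunLike.congr_fun (hT a)
    have h3 : ∀ a b x, π (a * b) x = π a (π b x) := fun a b x => by rw [map_mul]; rfl
    conv_lhs => rw [h1, ih]
    rw [map_smul, h2, map_smul, smul_smul, phaseProd, h3, pow_succ' c, pow_succ' (T : H →L[ℂ] H)]
    rfl

/-- Up to a phase, rotating finitely many spins moves the state vector no more than rotating the
whole right half-chain. -/
theorem norm_pow_mul_sub_one_le (hφ : ∀ a, inner ℂ Ω (π a Ω) = φ a) (hΩ : ‖Ω‖ = 1)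
    (hT : ∀ a, (T : H →L[ℂ] H) * π a = π (translation 1 a) * T)
    (hTΩ : (T : H →L[ℂ] H) Ω = Ω) {θ : ℝ} {c : ℂ} (hc : ‖c‖ = 1) {V : H →L[ℂ] H}
    (hV : V = c • shiftImplementer π T θ V) (n : ℕ) :
    ‖c ^ n * φ (phaseProd (Complex.exp (-(Complex.I * θ))) n) - 1‖ ≤ 2 * ‖V Ω - Ω‖ := by
  set v := phaseProd (Complex.exp (-(Complex.I * θ))) n with hv
  have hvv : star v * v = 1 := phaseProd_star_mul_self (norm_exp_neg_I_mul θ) n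
  have h1 : c ^ n * φ v - 1 = inner ℂ Ω (c ^ n • π v Ω - Ω) := by
    rw [inner_sub_right, inner_smul_right, hφ, inner_self_eq_norm_sq_to_K, hΩ]
    simp
  -- Both terms have norm `‖V Ω - Ω‖`, because `π v` and `T ^ n` are isometric and `c` is a phase.
  -- This is why the bound is uniform in `n`.
  have h2 : c ^ n • π v Ω - Ω =
      c ^ n • π v (((T : H →L[ℂ] H) ^ n) (Ω - V Ω)) + (V Ω - Ω) := by
    rw [map_sub, unitary_pow_apply_fixed hTΩ, map_sub, smul_sub, ← apply_eq_pow_smul hT hTΩ hV n]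
    abel
  rw [h1]
  refine (norm_inner_le_norm _ _).trans ?_
  rw [hΩ, one_mul, h2]
  refine (norm_add_le _ _).trans ?_
  rw [norm_smul, norm_pow, hc, one_pow, one_mul, norm_map_of_star_mul_self hvv,
    norm_unitary_pow_apply, norm_sub_rev, two_mul]

theorem tendsto_phaseProd (htrans : ∀ (k : ℤ) (a : quasiLocal), φ (translation k a) = φ a)
    (n : ℕ) : Filter.Tendsto (fun θ : ℝ => φ (phaseProd (Complex.exp (-(Complex.I * θ))) n))
      (nhds 0) (nhds 1) := by
  obtain ⟨ι, hι, w, N, -, hw1, -, hz, -⟩ := exists_distribution htrans n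
  simp only [hz]
  have hc : Continuous fun θ : ℝ => ∑ a, (w a : ℂ) * Complex.exp (-(Complex.I * θ)) ^ N a := by
    fun_prop
  have := hc.tendsto 0
  simpa [← Complex.ofReal_sum, hw1] using this

set_option maxHeartbeats 1000000 in
/-- The density of down spins is `0` or `1`. -/
theorem density_eq_zero_or_one (hπ : IsIrreducibleRep π) (hφ : ∀ a, inner ℂ Ω (π a Ω) = φ a)
    (hΩ : ‖Ω‖ = 1) (htrans : ∀ (k : ℤ) (a : quasiLocal), φ (translation k a) = φ a)
    (hT : ∀ a, (T : H →L[ℂ] H) * π a = π (translation 1 a) * T)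
    (hTΩ : (T : H →L[ℂ] H) Ω = Ω) {U : ℝ → unitary (H →L[ℂ] H)}
    (hU : ∀ᶠ θ in nhds 0, Implements π θ (U θ))
    (hUc : Filter.Tendsto (fun θ => (U θ : H →L[ℂ] H) Ω) (nhds 0) (nhds Ω)) :
    φ (site 1 (Matrix.single 1 1 1)) = 0 ∨ φ (site 1 (Matrix.single 1 1 1)) = 1 := by
  have : Nontrivial H := ⟨⟨Ω, 0, fun h => by rw [h, norm_zero] at hΩ; exact zero_ne_one hΩ⟩⟩
  obtain ⟨χ, hχn, hχm, hχp, hχ⟩ := hπ.exists_character hT (exists_implements_of_eventually hU)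
  have hε : Filter.Tendsto (fun θ => 2 * ‖(U θ : H →L[ℂ] H) Ω - Ω‖) (nhds 0) (nhds 0) := by
    simpa using ((hUc.sub_const Ω).norm).const_mul 2
  have hbd : ∀ᶠ θ in nhds 0, ∀ n : ℕ,
      ‖χ θ ^ n * φ (phaseProd (Complex.exp (-(Complex.I * θ))) n) - 1‖ ≤
        2 * ‖(U θ : H →L[ℂ] H) Ω - Ω‖ :=
    hU.mono fun θ hθ n => norm_pow_mul_sub_one_le hφ hΩ hT hTΩ (hχn θ) (hχ θ (U θ) hθ) n
  -- Continuity of the character comes from the bound with `n = 1`, as the one-site expectation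
  -- itself tends to `1`.
  have hχ1 : Filter.Tendsto χ (nhds 0) (nhds 1) := by
    rw [tendsto_iff_norm_sub_tendsto_zero]
    have h1 : Filter.Tendsto (fun θ : ℝ =>
        ‖φ (phaseProd (Complex.exp (-(Complex.I * θ))) 1) - 1‖) (nhds 0) (nhds 0) := by
      simpa using ((tendsto_phaseProd htrans 1).sub_const 1).norm
    refine squeeze_zero' (Filter.Eventually.of_forall fun _ => norm_nonneg _) ?_
      (by simpa using h1.add hε)
    filter_upwards [hbd] with θ hθ
    have h2 := hθ 1
    rw [pow_one] at h2
    set y := φ (phaseProd (Complex.exp (-(Complex.I * θ))) 1)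
    have h3 : ‖χ θ * (1 - y)‖ = ‖y - 1‖ := by rw [norm_mul, hχn, one_mul, norm_sub_rev]
    calc ‖χ θ - 1‖ = ‖χ θ * (1 - y) + (χ θ * y - 1)‖ := by congr 1; ring
      _ ≤ ‖y - 1‖ + 2 * ‖(U θ : H →L[ℂ] H) Ω - Ω‖ := by
        rw [← h3]; exact (norm_add_le _ _).trans (by gcongr)
  obtain ⟨m, hm⟩ := exists_int_of_character hχm hχn hχp hχ1
  obtain ⟨p, hp, hp0, hp1⟩ : ∃ p : ℝ, φ (site 1 (Matrix.single 1 1 1)) = p ∧ 0 ≤ p ∧ p ≤ 1 := by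
    obtain ⟨ι, hι, w, N, hw, hw1, hN, -, hs⟩ := exists_distribution htrans 1
    refine ⟨∑ a, w a * N a, by rw [hs]; simp,
      Finset.sum_nonneg fun a _ => mul_nonneg (hw a) (Nat.cast_nonneg _), ?_⟩
    rw [← hw1]
    refine Finset.sum_le_sum fun a _ => mul_le_of_le_one_right (hw a) ?_
    exact_mod_cast hN a
  have hpm : p = m := by
    by_contra hne
    have hd : 0 < |p - m| := abs_pos.mpr (sub_ne_zero.mpr hne)
    -- With `|N - mn| ≤ M n` and the tolerance `|p - m| / (4M)` below, the error term of
    -- `abs_sum_le_of_sum_cos_le` is `n |p - m| / 2`, half of the mean. The other half would then be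
    -- bounded in `n`.
    set M : ℝ := 1 + |(m : ℝ)| with hM
    have hM0 : 0 < M := by positivity
    obtain ⟨δ₀, hδ₀, hδ⟩ := Metric.eventually_nhds_iff.mp
      (hbd.and (hε.eventually (ge_mem_nhds (show 0 < |p - m| / (4 * M) by positivity))))
    -- The estimates hold on the open ball of radius `δ₀`; halving it gives a closed interval
    -- inside.
    have hle : ∀ n : ℕ, n * (|p - m| / 2) ≤ 2 / (δ₀ / 2) := by
      intro n
      obtain ⟨ι, hι, w, N, hw, hw1, hN, hz, hs⟩ := exists_distribution htrans n
      have hx : ∀ a, |(N a : ℝ) - m * n| ≤ M * n := by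
        intro a
        have h1 : (N a : ℝ) ≤ n := by exact_mod_cast hN a
        calc |(N a : ℝ) - m * n| ≤ |(N a : ℝ)| + |(m : ℝ) * n| := abs_sub _ _
          _ ≤ n + |(m : ℝ)| * n := by
            rw [abs_mul, Nat.abs_cast, Nat.abs_cast]; gcongr
          _ = M * n := by rw [hM]; ring
      have h := abs_sum_le_of_sum_cos_le (x := fun a => (N a : ℝ) - m * n) hw hw1
        (half_pos hδ₀) hx (by positivity) (η := |p - m| / (4 * M)) (fun θ hθ => by
          obtain ⟨h1, h2⟩ := hδ (y := θ) (by
            rw [Real.dist_eq, sub_zero, abs_of_nonneg hθ.1]; linarith [hθ.2])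
          refine le_trans ?_ ((h1 n).trans h2)
          have h3 : χ θ ^ n * φ (phaseProd (Complex.exp (-(Complex.I * θ))) n) =
              ∑ a, (w a : ℂ) * Complex.exp (((-(θ * ((N a : ℝ) - m * n)) : ℝ) : ℂ) *
                Complex.I) := by
            rw [hz, hm, Finset.mul_sum]
            refine Finset.sum_congr rfl fun a _ => ?_
            rw [← Complex.exp_nat_mul, ← Complex.exp_nat_mul, mul_left_comm, ← Complex.exp_add]
            congr 2
            push_cast
            ring
          have h4 : ∑ a, w a * (1 - Real.cos (θ * ((N a : ℝ) - m * n))) =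
              -(χ θ ^ n * φ (phaseProd (Complex.exp (-(Complex.I * θ))) n) - 1).re := by
            rw [h3, Complex.sub_re, Complex.re_sum]
            simp only [Complex.re_ofReal_mul, Complex.exp_ofReal_mul_I_re, Real.cos_neg, mul_sub,
              mul_one, Finset.sum_sub_distrib, hw1, Complex.one_re]
            ring
          rw [h4]
          exact (neg_le_abs _).trans (Complex.abs_re_le_norm _))
      have h5 : ∑ a, w a * ((N a : ℝ) - m * n) = n * (p - m) := by
        have h6 : ∑ a, w a * N a = n * p := by
          rw [hp] at hs
          exact_mod_cast hs
        simp only [mul_sub, Finset.sum_sub_distrib, h6, ← Finset.sum_mul, hw1]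
        ring
      rw [h5, abs_mul, Nat.abs_cast] at h
      have h7 : 2 * (M * n) * (|p - m| / (4 * M)) = n * (|p - m| / 2) := by
        field_simp
        ring
      rw [h7] at h
      linarith
    obtain ⟨n, hn⟩ := exists_nat_gt (2 / (δ₀ / 2) / (|p - m| / 2))
    rw [div_lt_iff₀ (half_pos hd)] at hn
    exact absurd (hle n) (not_le.mpr hn)
  rw [hpm] at hp0 hp1 hp
  have hm0 : 0 ≤ m := by exact_mod_cast hp0
  have hm1 : m ≤ 1 := by exact_mod_cast hp1
  rw [hp]
  have : m = 0 ∨ m = 1 := by omega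
  rcases this with rfl | rfl <;> simp

set_option maxHeartbeats 1000000 in
/-- A state in which every spin points in the direction `i` is a product state. -/
theorem isProductState_of_single (hφ : ∀ a, inner ℂ Ω (π a Ω) = φ a) {i : Fin 2}
    (h : ∀ j, φ (site j (Matrix.single i i 1)) = 1) : IsProductState φ := by
  -- For the projection `e` at site `j`, `‖π (1 - e) Ω‖² = φ (1 - e) = 0`.
  have hfix : ∀ j, π (site j (Matrix.single i i 1)) Ω = Ω := by
    intro j
    set e := site j (Matrix.single i i 1) with he
    have hee : star e * e = e := star_site_single_mul_self j i
    have hes : star e = e := by rw [← hee, star_mul, star_star]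
    have h0 : star (1 - e) * (1 - e) = 1 - e := by
      rw [star_sub, star_one, hes, mul_sub, mul_one, sub_mul, one_mul]
      rw [hes] at hee
      rw [hee]
      abel
    have h1 : inner ℂ (π (1 - e) Ω) (π (1 - e) Ω) = (0 : ℂ) := by
      rw [inner_map_left]
      have : π (star (1 - e)) (π (1 - e) Ω) = π (star (1 - e) * (1 - e)) Ω := by
        rw [map_mul]; rfl
      rw [this, h0, hφ, map_sub, h j, show φ.toLinearMap 1 = 1 from φ.map_one, sub_self]
    rw [inner_self_eq_zero, map_sub, _root_.map_one, sub_apply, one_apply_eq_self, sub_eq_zero] at h1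
    exact h1.symm
  have hright : ∀ j a, φ (a * site j (Matrix.single i i 1)) = φ a := by
    intro j a
    rw [← hφ, ← hφ, map_mul, mul_apply_eq_comp, hfix]
  have hleft : ∀ j a, φ (site j (Matrix.single i i 1) * a) = φ a := by
    intro j a
    have hee : star (site j (Matrix.single i i 1)) * site j (Matrix.single i i 1) =
      site j (Matrix.single i i 1) := star_site_single_mul_self j i
    have hes : star (site j (Matrix.single i i 1)) = site j (Matrix.single i i 1) := by
      rw [← hee, star_mul, star_star]
    rw [← hφ, ← hφ, map_mul, mul_apply_eq_comp]
    nth_rewrite 1 [← hes]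
    rw [← inner_map_left, hfix]
  -- The projection at `j` can be inserted on both ends for free and moved through `R` to compress
  -- `Q` to the scalar `Q i i`.
  have hstep : ∀ j Q R, Commute R (site j (Matrix.single i i 1)) →
      φ (site j Q * R) = Q i i * φ R := by
    intro j Q R hR
    have h1 : (Matrix.single i i 1 * Q * Matrix.single i i 1 : Matrix (Fin 2) (Fin 2) ℂ) =
        Q i i • Matrix.single i i 1 := by
      rw [Matrix.single_mul_mul_single]
      simp [Matrix.smul_single]
    rw [← hleft j, ← hright j, mul_assoc, mul_assoc, hR.eq, ← mul_assoc, ← mul_assoc, ← map_mul,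
      ← map_mul, h1, map_smul, smul_mul_assoc, map_smul, hleft, smul_eq_mul]
  have hone : ∀ j Q, φ (site j Q) = Q i i := by
    intro j Q
    have := hstep j Q 1 (Commute.one_left _)
    rwa [mul_one, show φ.toLinearMap 1 = 1 from φ.map_one, mul_one] at this
  intro l Q hl
  induction l with
  | nil => simpa using φ.map_one
  | cons j t ih =>
    rw [List.nodup_cons] at hl
    rw [List.map_cons, List.prod_cons, List.map_cons, List.prod_cons, hstep, ih hl.2, hone]
    refine Commute.list_prod_left _ _ fun x hx => ?_
    obtain ⟨k, hk, rfl⟩ := List.mem_map.mp hx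
    have hkj : k ≠ j := fun h => hl.1 (h ▸ hk)
    exact site_commute hkj _ _

theorem isProductState_of_density (hφ : ∀ a, inner ℂ Ω (π a Ω) = φ a)
    (htrans : ∀ (k : ℤ) (a : quasiLocal), φ (translation k a) = φ a)
    (h : φ (site 1 (Matrix.single 1 1 1)) = 0 ∨ φ (site 1 (Matrix.single 1 1 1)) = 1) :
    IsProductState φ := by
  have hj : ∀ j Q, φ (site j Q) = φ (site 1 Q) := fun j Q => by
    rw [← htrans (j - 1) (site 1 Q), translation_site, sub_add_cancel]
  rcases h with h | h
  · refine isProductState_of_single hφ (i := 0) fun j => ?_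
    have h1 : site 1 (Matrix.single 0 0 1) = 1 - site 1 (Matrix.single 1 1 1) := by
      rw [eq_sub_iff_add_eq, ← map_add, ← _root_.map_one (site 1), ← phaseMatrix_one,
        ← single_add_smul_single, one_smul]
    rw [hj, h1, map_sub, h, sub_zero]
    exact φ.map_one
  · exact isProductState_of_single hφ (i := 1) fun j => by rw [hj, h]

end Conclusion

end SpinChain

theorem mainTheorem6 (φ : SpinChain.State SpinChain.quasiLocal)
    (hpure : φ.IsPure)
    (htrans : ∀ (k : ℤ) (a : SpinChain.quasiLocal), φ (SpinChain.translation k a) = φ a)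
    (hgauge : ∀ (θ : ℝ) (a : SpinChain.quasiLocal), φ (SpinChain.gauge θ a) = φ a)
    (htypeI : (φ.restrict SpinChain.rightAlgebra).IsTypeIRep) :
    SpinChain.IsProductState φ :=
  (SpinChain.State.exists_unitary_of_invariant _ (htrans 1)).elim fun _ hT =>
    (hpure.exists_implements_tendsto hgauge htypeI).elim fun _ hU =>
      SpinChain.isProductState_of_density φ.inner_cyclicVector_gnsRep htrans
        (SpinChain.density_eq_zero_or_one hpure.isIrreducibleRep φ.inner_cyclicVector_gnsRep
          φ.norm_cyclicVector htrans hT.2 hT.1 hU.1 (hU.2 _))
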